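/- Let $\Gamma=\mathrm{SL}_2(\mathbb Z)$ act on the upper half plane $\mathbb H$, write $z=x+iy\in\mathbb H$, let $\Gamma_\infty=\{\pm\begin{pmatrix}1&n\\0&1\end{pmatrix}:n\in\mathbb Z\}$, and put $j(\gamma,z)=cz+d$ for $\gamma=\begin{pmatrix}a&b\\c&d\end{pmatrix}\in\Gamma$. For an even integer $k$ and $\mathrm{Re}(s)>1$ define $$E_k(z,s)=\sum_{\gamma\in\Gamma_\infty\backslash\Gamma}\left(\frac{j(\gamma,z)}{|j(\gamma,z)|}\right)^{-k}\mathrm{Im}(\gamma z)^s .$$ Let $\theta_k$ be the meromorphic function $$\theta_k(s)=\pi^{-s}\,\Gamma(s)\,\zeta(2s)\cdot s(s+1)\cdots(s+|k|/2-1)$$ on $\mathbb C$, where removable singularities are removed, and let $E^*_k(z,s)$ be the meromorphic continuation of $\theta_k(s)E_k(z,s)$ in $s$ from $\mathrm{Re}(s)>1$ to all $s\in\mathbb C$. The harmonic Eisenstein series of weight $k$ is $$\mathbb E_k(z)=y^{-k/2}\,\frac{E^*_k(z,k/2)}{\theta_k(k/2)}\quad(k\neq 0),\qquad \mathbb E_0(z)=\lim_{s\to0}\frac{E^*_0(z,s)}{\theta_0(s)}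 .$$ Write $\sigma_w(m)=\sum_{d\mid m}d^w$, and let $\varepsilon(k)=2$ if $k\ge 0$ and $\varepsilon(k)=1$ if $k<0$; for $k=0$ the factor $\varepsilon(k)/\zeta(1-k)$ is understood to be $0$, since $\zeta$ has a pole at $1$. **Theorem.** For every even integer $k$ (positive, negative or zero) and every $z=x+iy\in\mathbb H$, the objects above are well defined: the series $E_k(z,s)$ converges absolutely for $\mathrm{Re}(s)>1$; the meromorphic continuation $E^*_k(z,s)$ exists; if $k\ne0$, both $E^*_k(z,\cdot)$ and $\theta_k$ are analytic at $s=k/2$, with $\theta_k(k/2)\neq0$; and if $k=0$, the limit defining $\mathbb E_0(z)$ exists. Moreover $$\mathbb E_k(z)=1+\frac{\varepsilon(k)}{\zeta(1-k)}\left[\frac{\zeta(2-k)}{(2\pi i)^k}\left(\frac y\pi\right)^{1-k}+\sum_{m=1}^\infty\sigma_{k-1}(m)\,e^{2\pi i mz}+V_k(z)\right],$$ where $$V_k(z)=\sum_{m=1}^\infty\sigma_{k-1}(m)\,e^{-2\pi i m\overline z}\sum_{u=0}^{-k}\frac{(4\pi my)^u}{u!}$$ (the inner sum is empty, so that $V_k=0$,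 for $k>0$), and both series over $m$ converge absolutely. -/

import Mathlib

open scoped UpperHalfPlane MatrixGroups

noncomputable section

namespace HarmonicEis

/-- The group `Γ_∞ = {± (1 n; 0 1) : n ∈ ℤ}` inside `SL(2, ℤ)`
(`ModularGroup.T` is the matrix `(1 1; 0 1)`). -/
def GammaInf : Subgroup SL(2, ℤ) where
  carrier := {γ | ∃ n : ℤ, γ = ModularGroup.T ^ n ∨ γ = -ModularGroup.T ^ n}
  one_mem' := ⟨0, Or.inl (by simp)⟩
  mul_mem' := by
    rintro a b ⟨m, rfl | rfl⟩ ⟨n, rfl | rfl⟩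
    · exact ⟨m + n, Or.inl (by rw [zpow_add])⟩
    · exact ⟨m + n, Or.inr (by rw [zpow_add, mul_neg])⟩
    · exact ⟨m + n, Or.inr (by rw [zpow_add, neg_mul])⟩
    · exact ⟨m + n, Or.inl (by rw [zpow_add, neg_mul_neg])⟩
  inv_mem' := by
    rintro a ⟨m, rfl | rfl⟩
    · exact ⟨-m, Or.inl (by rw [zpow_neg])⟩
    · exact ⟨-m, Or.inr (by rw [zpow_neg]; exact inv_eq_of_mul_eq_one_right (by simp))⟩

/-- The automorphy factor `j(γ, z) = c z + d` for `γ = (a b; c d)`. -/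
def j (γ : SL(2, ℤ)) (z : ℍ) : ℂ := (γ 1 0 : ℂ) * (z : ℂ) + (γ 1 1 : ℂ)

/-- The summand `(j(γ, z) / |j(γ, z)|)^(-k) * Im(γ z)^s`. -/
def eisTerm (k : ℤ) (z : ℍ) (s : ℂ) (γ : SL(2, ℤ)) : ℂ :=
  (j γ z / (‖j γ z‖ : ℂ)) ^ (-k) * (((γ • z).im : ℝ) : ℂ) ^ s

/-- For even `k` the summand depends only on the coset `Γ_∞ γ`. -/
theorem eisTerm_mul_left {k : ℤ} (hk : Even k) (z : ℍ) (s : ℂ) {g : SL(2, ℤ)}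
    (hg : g ∈ GammaInf) (γ : SL(2, ℤ)) : eisTerm k z s (g * γ) = eisTerm k z s γ := by
  have hT : ∀ n : ℤ, j (ModularGroup.T ^ n * γ) z = j γ z ∧
      ((ModularGroup.T ^ n * γ) • z).im = (γ • z).im := by
    intro n
    refine ⟨?_, ?_⟩
    · simp [j]
    · rw [mul_smul, UpperHalfPlane.modular_T_zpow_smul, UpperHalfPlane.vadd_im]
  have hneg : ∀ δ : SL(2, ℤ), eisTerm k z s (-δ) = eisTerm k z s δ := by
    intro δ
    have h1 : j (-δ) z = -j δ z := by
      simp only [j, Matrix.SpecialLinearGroup.coe_neg, Matrix.neg_apply, Int.cast_neg]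
      ring
    have h2 : (-δ) • z = δ • z := ModularGroup.SL_neg_smul δ z
    rw [eisTerm, h1, h2, norm_neg, neg_div, hk.neg.neg_zpow, eisTerm]
  obtain ⟨n, rfl | rfl⟩ := hg
  · rw [eisTerm, (hT n).1, (hT n).2, eisTerm]
  · rw [neg_mul, hneg, eisTerm, (hT n).1, (hT n).2, eisTerm]

/-- The series `E_k(z, s) = ∑_{γ ∈ Γ_∞ \ Γ} (j(γ, z) / |j(γ, z)|)^(-k) Im(γ z)^s` for
`Re s > 1`, summed over representatives of the cosets `Γ_∞ γ`; for even `k` the choice of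
representatives is immaterial, by `eisTerm_mul_left`. -/
def eisSeries (k : ℤ) (z : ℍ) (s : ℂ) : ℂ :=
  ∑' c : Quotient (QuotientGroup.rightRel GammaInf), eisTerm k z s c.out

/-- The meromorphic function
`θ_k(s) = θ(s) * s (s + 1) ⋯ (s + |k|/2 - 1)`, where `θ(s) = π^(-s) Γ(s) ζ(2s)`.
Passing to the normal form removes the removable singularities of this product, so that at every
point which is not a pole the value is the one given by continuity (at a pole it is `0`). -/
def thetaK (k : ℤ) : ℂ → ℂ :=
  toMeromorphicNFOn
    (fun s : ℂ => (Real.pi : ℂ) ^ (-s) * Complex.Gamma s * riemannZeta (2 * s) *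
      ∏ i ∈ Finset.range (k.natAbs / 2), (s + (i : ℂ)))
    Set.univ

/-- `F` is the meromorphic continuation to the whole `s`-plane of the completed series
`s ↦ θ_k(s) E_k(z, s)`, `Re s > 1`. The normal form condition says that `F` is meromorphic and is
analytic at every point which is not a pole; with it there is at most one such `F`. -/
def IsCompletedEis (k : ℤ) (z : ℍ) (F : ℂ → ℂ) : Prop :=
  MeromorphicNFOn F Set.univ ∧ ∀ s : ℂ, 1 < s.re → F s = thetaK k s * eisSeries k z s

/-- The continuation is unique. -/
theorem IsCompletedEis.unique {k : ℤ} {z : ℍ} {F G : ℂ → ℂ} (hF : IsCompletedEis k z F)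
    (hG : IsCompletedEis k z G) : F = G := by
  have hm : MeromorphicOn (F - G) Set.univ := hF.1.meromorphicOn.sub hG.1.meromorphicOn
  have h2 : meromorphicOrderAt (F - G) 2 = ⊤ := by
    rw [meromorphicOrderAt_eq_top_iff]
    refine Filter.Eventually.filter_mono nhdsWithin_le_nhds ?_
    have ho : {s : ℂ | 1 < s.re} ∈ nhds (2 : ℂ) :=
      (isOpen_lt continuous_const Complex.continuous_re).mem_nhds (by simp)
    filter_upwards [ho] with s hs
    simp [hF.2 s hs, hG.2 s hs]
  funext s
  have hs : meromorphicOrderAt (F - G) s = ⊤ := by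
    by_contra h
    exact hm.meromorphicOrderAt_ne_top_of_isPreconnected isPreconnected_univ
      (Set.mem_univ s) (Set.mem_univ 2) h h2
  rw [meromorphicOrderAt_eq_top_iff] at hs
  refine ((hF.1 (Set.mem_univ s)).eventuallyEq_nhdsNE_iff_eventuallyEq_nhds
    (hG.1 (Set.mem_univ s))).1 ?_ |>.eq_of_nhds
  filter_upwards [hs] with t ht
  exact sub_eq_zero.1 ht

open Classical in
/-- The completed Eisenstein series `E*_k(z, s)` for all complex `s`, by continuation in `s`. -/
def completedEis (k : ℤ) (z : ℍ) : ℂ → ℂ :=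
  if h : ∃ F : ℂ → ℂ, IsCompletedEis k z F then h.choose else 0

/-- The harmonic Eisenstein series `𝔼_k(z) = y^(-k/2) E*_k(z, k/2) / θ_k(k/2)` for `k ≠ 0`, and
`𝔼_0(z) = lim_{s → 0} E*_0(z, s) / θ_0(s)`. -/
def harmonicEis (k : ℤ) (z : ℍ) : ℂ :=
  if k = 0 then
    Filter.limUnder (nhdsWithin (0 : ℂ) {0}ᶜ) (fun s : ℂ => completedEis 0 z s / thetaK 0 s)
  else
    (z.im : ℂ) ^ (-(k : ℂ) / 2) * (completedEis k z ((k : ℂ) / 2) / thetaK k ((k : ℂ) / 2))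

/-- The divisor power function `σ_w(m) = ∑_{d ∣ m} d^w`, for an integer `w` of any sign. -/
def sigma (w : ℤ) (m : ℕ+) : ℂ := ∑ d ∈ (m : ℕ).divisors, (d : ℂ) ^ w

/-- `ε(k) = 2` if `k ≥ 0` and `ε(k) = 1` if `k < 0`. -/
def eps (k : ℤ) : ℂ := if 0 ≤ k then 2 else 1

/-- The factor `ε(k) / ζ(1 - k)`, which is `0` for `k = 0` since `ζ` has a pole at `1`. -/
def epsOverZeta (k : ℤ) : ℂ := if k = 0 then 0 else eps k / riemannZeta (1 - (k : ℂ))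

/-- The terms `σ_{k-1}(m) e^{2π i m z}`, `m ≥ 1`. -/
def holTerm (k : ℤ) (z : ℍ) (m : ℕ+) : ℂ :=
  sigma (k - 1) m * Complex.exp (2 * Real.pi * Complex.I * (m : ℂ) * (z : ℂ))

/-- The terms `σ_{k-1}(m) e^{-2π i m z̄} ∑_{u=0}^{-k} (4π m y)^u / u!`, `m ≥ 1`, of `V_k(z)`;
the inner sum is empty for `k > 0`. -/
def nonholTerm (k : ℤ) (z : ℍ) (m : ℕ+) : ℂ :=
  sigma (k - 1) m *
    Complex.exp (-(2 * Real.pi * Complex.I * (m : ℂ) * (starRingEnd ℂ) (z : ℂ))) *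
    ∑ u ∈ Finset.range (1 - k).toNat,
      (4 * (Real.pi : ℂ) * (m : ℂ) * (z.im : ℂ)) ^ u / (u.factorial : ℂ)

end HarmonicEis

end

open HarmonicEis

/-! Up to the factor `2 ζ(2s)`, the series `E_k(z, s)` is the sum of `(w/|w|)^(-k) (y/|w|²)^s` over
nonzero `w = m z + n`: each coset of `Γ_∞` gives two coprime pairs, and the gcd contributes `ζ(2s)`
(`tsum_latTerm`). This lattice sum is a Mellin transform of the theta series with terms `P(w) exp(-π
t |w|²/y)`, where `P` is `w̄^k` or `w^|k|`, and that series has weight `|k| + 1` under `t ↦ 1/t`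
(`thetaWt_functional_equation`). So `E*_k` continues and is invariant under `s ↦ 1 - s`
(`eisLambda_one_sub`). Poles can come only from the term `w = 0`, which vanishes unless `k = 0`.

It remains to evaluate at `s = k/2`. For `k = 0` numerator and denominator both have residue `-1/2`
at `0`. For `k ≥ 4` the point lies in the region of convergence, the sum is the classical
holomorphic Eisenstein series, and the power of `y` drops out because `ζ(2 - k) = 0`.

For `k = -2K < 0` the functional equation moves `s = -K` to `s = K + 1`, where the lattice sum has
terms `1/(w w̄^(2K+1))`. Partial fractions in `n` and Lipschitz's formula turn each row `m ≥ 1` into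
exponentials and truncated exponential sums (`tsum_inv_mul_conj_pow`); the row `m = 0` gives the
power of `y`, and the constants of the other rows add up to `ζ(1 - k)`, which cancels against
`θ_k(k/2)`.

For `k = 2` the point `s = 1` is on the boundary of convergence, and a form of Hecke's trick is
used. A combination of the summands of weights 2 and 0 at `s = 1 + σ` is an exact derivative along
each row. Subtracting its mean over unit segments, which telescopes to zero over the row, leaves
terms `O(|w|⁻³)` uniformly in `σ`, so `σ → 0` may be taken termwise. The pole of `E*_0` at `s = 1`
supplies the nonholomorphic term (`eisLambda_two_one`). -/

namespace HarmonicEis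

open Complex Filter Topology
open scoped Real ComplexConjugate

/-! ### Convergence of sums over the lattice ℤz + ℤ -/

/-- The linear form `v₀ z + v₁`. -/
noncomputable def lin (z : ℍ) (v : Fin 2 → ℤ) : ℂ := (v 0 : ℂ) * (z : ℂ) + (v 1 : ℂ)

@[simp] lemma lin_zero (z : ℍ) : lin z 0 = 0 := by simp [lin]

lemma lin_ne_zero (z : ℍ) {v : Fin 2 → ℤ} (hv : v ≠ 0) : lin z v ≠ 0 := by
  intro h
  have h1 := EisensteinSeries.r_mul_max_le z hv
  have h2 : 0 < ‖v‖ := norm_pos_iff.mpr hv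
  have h3 := EisensteinSeries.r_pos z
  rw [lin] at h
  rw [h, norm_zero] at h1
  nlinarith [mul_pos h3 h2]

lemma r_le_norm_lin (z : ℍ) {v : Fin 2 → ℤ} (hv : v ≠ 0) :
    EisensteinSeries.r z ≤ ‖lin z v‖ := by
  refine le_trans ?_ (EisensteinSeries.r_mul_max_le z hv)
  have h3 := EisensteinSeries.r_pos z
  have : 1 ≤ ‖v‖ := by
    rw [EisensteinSeries.norm_eq_max_natAbs]
    have : 1 ≤ max (v 0).natAbs (v 1).natAbs := by
      by_contra h
      apply hv
      ext i
      fin_cases i <;> simp <;> omega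
    exact_mod_cast this
  nlinarith

lemma summable_norm_lin_rpow (z : ℍ) {p : ℝ} (hp : 2 < p) :
    Summable fun v : Fin 2 → ℤ => ‖lin z v‖ ^ (-p) := by
  refine Summable.of_nonneg_of_le (fun v => by positivity)
    (fun v => EisensteinSeries.summand_bound z (by linarith : (0 : ℝ) ≤ p) v)
    ((EisensteinSeries.summable_one_div_norm_rpow hp).mul_left _)

lemma summable_exp_neg_norm_lin (z : ℍ) {c : ℝ} (hc : 0 < c) :
    Summable fun v : Fin 2 → ℤ => Real.exp (-c * ‖lin z v‖) := by
  refine Summable.of_norm_bounded_eventually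
    ((summable_norm_lin_rpow z (p := 3) (by norm_num)).mul_left (6 / c ^ 3)) ?_
  have : ∀ᶠ v : Fin 2 → ℤ in cofinite, v ≠ 0 := by simp
  filter_upwards [this] with v hv
  have hx : 0 < ‖lin z v‖ := norm_pos_iff.mpr (lin_ne_zero z hv)
  rw [Real.norm_of_nonneg (Real.exp_pos _).le, neg_mul, Real.exp_neg, Real.rpow_neg hx.le,
    show (3 : ℝ) = ((3 : ℕ) : ℝ) by norm_num, Real.rpow_natCast]
  have h := Real.pow_div_factorial_le_exp (c * ‖lin z v‖) (by positivity) 3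
  rw [mul_pow] at h
  norm_num [Nat.factorial] at h
  rw [inv_le_comm₀ (Real.exp_pos _) (by positivity)]
  refine le_trans (le_of_eq ?_) h
  field_simp

/-- Completing the square: the constant is the maximum over `x` of `(b + 1) x - a x²`. -/
lemma exp_gauss_le {a b x : ℝ} (ha : 0 < a) :
    Real.exp (b * x - a * x ^ 2) ≤ Real.exp ((b + 1) ^ 2 / (4 * a)) * Real.exp (-1 * x) := by
  rw [← Real.exp_add, Real.exp_le_exp, ← sub_nonneg]
  have : (b + 1) ^ 2 / (4 * a) + -1 * x - (b * x - a * x ^ 2)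
      = (2 * a * x - (b + 1)) ^ 2 / (4 * a) := by
    field_simp
    ring
  rw [this]
  positivity

lemma summable_exp_gauss (z : ℍ) {a : ℝ} (ha : 0 < a) (b : ℝ) :
    Summable fun v : Fin 2 → ℤ => Real.exp (b * ‖lin z v‖ - a * ‖lin z v‖ ^ 2) :=
  Summable.of_nonneg_of_le (fun _ => (Real.exp_pos _).le) (fun _ => exp_gauss_le ha)
    ((summable_exp_neg_norm_lin z one_pos).mul_left _)

lemma summable_pow_mul_gauss (z : ℍ) {a : ℝ} (ha : 0 < a) (d : ℕ) :
    Summable fun v : Fin 2 → ℤ => ‖lin z v‖ ^ d * Real.exp (-a * ‖lin z v‖ ^ 2) := by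
  refine Summable.of_nonneg_of_le (fun _ => by positivity) (fun v => ?_)
    ((summable_exp_gauss z ha 1).mul_left (d.factorial : ℝ))
  have h := Real.pow_div_factorial_le_exp (‖lin z v‖) (norm_nonneg _) d
  rw [div_le_iff₀ (by positivity)] at h
  rw [sub_eq_add_neg, Real.exp_add, one_mul, ← neg_mul]
  calc _ ≤ (Real.exp ‖lin z v‖ * d.factorial) * Real.exp (-a * ‖lin z v‖ ^ 2) := by gcongr
    _ = _ := by ring

/-! ### Poisson summation for the theta generating function -/

/-- Generating function of the theta series with harmonic coefficients. -/
noncomputable def thetaGen (z : ℍ) (t : ℝ) (α : ℂ) : ℂ :=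
  ∑' v : Fin 2 → ℤ, cexp (-(π * t / z.im * ‖lin z v‖ ^ 2 : ℝ) + α * conj (lin z v))

lemma norm_thetaGen_term_le (z : ℍ) (t : ℝ) (α : ℂ) (v : Fin 2 → ℤ) :
    ‖cexp (-(π * t / z.im * ‖lin z v‖ ^ 2 : ℝ) + α * conj (lin z v))‖ ≤
      Real.exp (‖α‖ * ‖lin z v‖ - π * t / z.im * ‖lin z v‖ ^ 2) := by
  rw [Complex.norm_exp, Real.exp_le_exp, add_re, ← ofReal_neg, ofReal_re]
  have : (α * conj (lin z v)).re ≤ ‖α‖ * ‖lin z v‖ := by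
    refine (re_le_norm _).trans ?_
    rw [norm_mul, RCLike.norm_conj]
  linarith

lemma summable_thetaGen (z : ℍ) {t : ℝ} (ht : 0 < t) (α : ℂ) :
    Summable fun v : Fin 2 → ℤ =>
      cexp (-(π * t / z.im * ‖lin z v‖ ^ 2 : ℝ) + α * conj (lin z v)) :=
  Summable.of_norm_bounded (summable_exp_gauss z (a := π * t / z.im)
    (by have := z.im_pos; positivity) ‖α‖) (norm_thetaGen_term_le z t α)

/-- The summand obtained from `thetaGen` by Poisson summation in one variable. -/
noncomputable def thetaDual (z : ℍ) (t : ℝ) (α : ℂ) (m r : ℤ) : ℂ :=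
  cexp (2 * π * I * r * m * z.re - π * z.im * (m ^ 2 * t + r ^ 2 / t)
    - I * α * z.im * (m + r / t))

/-- This symmetry is why Poisson summation in one variable suffices: after it, inverting `t` merely
exchanges the untouched index with the dual one. -/
lemma thetaDual_inv (z : ℍ) {t : ℝ} (ht : 0 < t) (α : ℂ) (m r : ℤ) :
    thetaDual z (1 / t) (α / t) m r = thetaDual z t α r m := by
  have : (t : ℂ) ≠ 0 := by exact_mod_cast ht.ne'
  rw [thetaDual, thetaDual]
  congr 1
  push_cast
  field_simp
  ring

lemma summable_thetaDual (z : ℍ) {t : ℝ} (ht : 0 < t) (α : ℂ) :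
    Summable fun p : ℤ × ℤ => thetaDual z t α p.1 p.2 := by
  have hy := z.im_pos
  have h1 : Summable fun m : ℤ => jacobiTheta₂_term m (-α * z.im / (2 * π)) (I * z.im * t) := by
    rw [summable_jacobiTheta₂_term_iff]
    rw [show I * (z.im : ℂ) * t = ((z.im * t : ℝ) : ℂ) * I by push_cast; ring, im_ofReal_mul, I_im]
    positivity
  have h2 : Summable fun m : ℤ =>
      jacobiTheta₂_term m (-α * z.im / (2 * π * t)) (I * z.im / t) := by
    rw [summable_jacobiTheta₂_term_iff]
    rw [show I * (z.im : ℂ) / t = ((z.im / t : ℝ) : ℂ) * I by push_cast; ring, im_ofReal_mul, I_im]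
    positivity
  have h3 := (h1.norm.mul_of_nonneg h2.norm (fun _ => norm_nonneg _) (fun _ => norm_nonneg _))
  refine Summable.of_norm_bounded h3 (fun p => le_of_eq ?_)
  have hpi : (π : ℂ) ≠ 0 := by exact_mod_cast Real.pi_ne_zero
  have ht' : (t : ℂ) ≠ 0 := by exact_mod_cast ht.ne'
  have : thetaDual z t α p.1 p.2 = cexp (((2 * π * p.2 * p.1 * z.re : ℝ) : ℂ) * I) *
      (jacobiTheta₂_term p.1 (-α * z.im / (2 * π)) (I * z.im * t) *
      jacobiTheta₂_term p.2 (-α * z.im / (2 * π * t)) (I * z.im / t)) := by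
    rw [thetaDual, jacobiTheta₂_term, jacobiTheta₂_term, ← Complex.exp_add, ← Complex.exp_add]
    congr 1
    push_cast
    field_simp
    ring_nf
    rw [I_sq]
    ring
  rw [this, norm_mul, norm_exp_ofReal_mul_I, one_mul, norm_mul]

/-- With the row `m` fixed, the sum over `n` is a Jacobi theta function, and Poisson summation is
its functional equation. -/
lemma thetaGen_inner (z : ℍ) {t : ℝ} (ht : 0 < t) (α : ℂ) (m : ℤ) :
    ∑' n : ℤ, cexp (-(π * t / z.im * ‖lin z ![m, n]‖ ^ 2 : ℝ) + α * conj (lin z ![m, n])) =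
      (1 / (t / z.im : ℂ) ^ (1 / 2 : ℂ)) * cexp (z.im * α ^ 2 / (4 * π * t)) *
        ∑' r : ℤ, thetaDual z t α m r := by
  have hy := z.im_pos
  have hpi : (π : ℂ) ≠ 0 := by exact_mod_cast Real.pi_ne_zero
  have ht' : (t : ℂ) ≠ 0 := by exact_mod_cast ht.ne'
  have hy' : (z.im : ℂ) ≠ 0 := by exact_mod_cast hy.ne'
  set x : ℂ := (z.re : ℂ) with hx
  set y : ℂ := (z.im : ℂ) with hyy
  -- In the exponent, as a polynomial in `n`, the linear coefficient is `2πi u` and the quadratic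
  -- one is `πi τ`.
  set u : ℂ := (α - 2 * π * t * m * x / y) / (2 * π * I) with hu
  set τ : ℂ := I * t / y with hτ
  have hz : (z : ℂ) = x + y * I := (re_add_im (z : ℂ)).symm
  have h1 : ∀ n : ℤ, cexp (-(π * t / z.im * ‖lin z ![m, n]‖ ^ 2 : ℝ) + α * conj (lin z ![m, n])) =
      cexp (-(π * t / y) * m ^ 2 * (x ^ 2 + y ^ 2) + α * m * x - I * α * m * y) *
        jacobiTheta₂_term n u τ := by
    intro n
    have hn : ((‖lin z ![m, n]‖ ^ 2 : ℝ) : ℂ) = (m * x + n) ^ 2 + m ^ 2 * y ^ 2 := by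
      rw [← normSq_eq_norm_sq, normSq_apply, lin]
      simp [hz, x, y]
      ring
    have hc : conj (lin z ![m, n]) = m * x + n - I * m * y := by
      simp [lin, hz, x, y]
      ring
    rw [ofReal_mul, hn, hc, jacobiTheta₂_term, ← Complex.exp_add]
    congr 1
    push_cast
    rw [← hyy, hu, hτ]
    field_simp
    ring_nf
    rw [I_sq]
    ring
  simp_rw [h1]
  rw [tsum_mul_left, ← jacobiTheta₂, jacobiTheta₂_functional_equation]
  have e1 : -I * τ = t / y := by
    rw [hτ, show -I * (I * t / y) = -(I * I) * (t / y) by ring, I_mul_I]; ring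
  rw [e1, jacobiTheta₂, mul_left_comm, ← tsum_mul_left, ← tsum_mul_left, ← tsum_mul_left]
  congr 1
  ext r
  have e2 : cexp (-(π * t / y) * m ^ 2 * (x ^ 2 + y ^ 2) + α * m * x - I * α * m * y) *
      (cexp (-π * I * u ^ 2 / τ) * jacobiTheta₂_term r (u / τ) (-1 / τ)) =
      cexp (y * α ^ 2 / (4 * π * t)) * thetaDual z t α m r := by
    rw [jacobiTheta₂_term, thetaDual, ← Complex.exp_add, ← Complex.exp_add, ← Complex.exp_add]
    congr 1
    rw [hu, hτ, ← hyy, ← hx]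
    field_simp
    ring_nf
    simp only [I_sq, I_pow_three]
    ring_nf
  linear_combination (1 / (t / y) ^ (1 / 2 : ℂ)) * e2

lemma thetaGen_eq (z : ℍ) {t : ℝ} (ht : 0 < t) (α : ℂ) :
    thetaGen z t α = (1 / (t / z.im : ℂ) ^ (1 / 2 : ℂ)) * cexp (z.im * α ^ 2 / (4 * π * t)) *
        ∑' p : ℤ × ℤ, thetaDual z t α p.1 p.2 := by
  have hs : Summable fun p : ℤ × ℤ => cexp (-(π * t / z.im * ‖lin z ![p.1, p.2]‖ ^ 2 : ℝ) +
      α * conj (lin z ![p.1, p.2])) :=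
    (finTwoArrowEquiv ℤ).symm.summable_iff.mpr (summable_thetaGen z ht α)
  rw [thetaGen, ← (finTwoArrowEquiv ℤ).symm.tsum_eq]
  simp only [finTwoArrowEquiv_symm_apply]
  rw [hs.tsum_prod, (summable_thetaDual z ht α).tsum_prod, ← tsum_mul_left]
  exact tsum_congr fun m => thetaGen_inner z ht α m

/-- The dual double sum is invariant up to swapping its indices, and so is `α²/t` under `(t, α) ↦
(1/t, α/t)`; only the square root in front changes, by the factor `t`. -/
lemma thetaGen_functional_equation (z : ℍ) {t : ℝ} (ht : 0 < t) (α : ℂ) :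
    thetaGen z (1 / t) (α / t) = t * thetaGen z t α := by
  have hy := z.im_pos
  have ht' : (t : ℂ) ≠ 0 := by exact_mod_cast ht.ne'
  rw [thetaGen_eq z (one_div_pos.mpr ht), thetaGen_eq z ht,
    ← (Equiv.prodComm ℤ ℤ).tsum_eq (fun p : ℤ × ℤ => thetaDual z t α p.1 p.2)]
  simp only [thetaDual_inv z ht, Equiv.prodComm_apply, Prod.fst_swap, Prod.snd_swap]
  have h1 : cexp (z.im * (α / t) ^ 2 / (4 * π * (1 / t : ℝ))) =
      cexp (z.im * α ^ 2 / (4 * π * t)) := by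
    congr 1
    push_cast
    field_simp
  have h2 : (1 / ((1 / t : ℝ) / z.im : ℂ) ^ (1 / 2 : ℂ)) =
      t * (1 / (t / z.im : ℂ) ^ (1 / 2 : ℂ)) := by
    have key : (1 / ((1 / t) / z.im : ℝ) ^ (1 / 2 : ℝ)) = t * (1 / (t / z.im : ℝ) ^ (1 / 2 : ℝ)) := by
      rw [← Real.sqrt_eq_rpow, ← Real.sqrt_eq_rpow, div_div, Real.sqrt_div' _ (by positivity),
        Real.sqrt_div' _ hy.le, Real.sqrt_one, Real.sqrt_mul ht.le, one_div_one_div, one_div_div,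
        mul_div_assoc', eq_div_iff (Real.sqrt_pos.mpr ht).ne', mul_right_comm,
        Real.mul_self_sqrt ht.le]
    have := congrArg (fun x : ℝ => (x : ℂ)) key
    simp only [ofReal_mul, ofReal_div, ofReal_one] at this
    rw [ofReal_cpow (by positivity), ofReal_cpow (by positivity)] at this
    simpa using this
  rw [h1, h2]
  ring

/-! ### Theta series with polynomial coefficients and their functional equation -/

/-- The theta series with coefficients `conj (v₀ z + v₁) ^ d`. -/
noncomputable def thetaCoeff (z : ℍ) (d : ℕ) (t : ℝ) : ℂ :=
  ∑' v : Fin 2 → ℤ, conj (lin z v) ^ d * Real.exp (-(π * t / z.im) * ‖lin z v‖ ^ 2)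

lemma summable_thetaCoeff (z : ℍ) (d : ℕ) {t : ℝ} (ht : 0 < t) :
    Summable fun v : Fin 2 → ℤ =>
      conj (lin z v) ^ d * (Real.exp (-(π * t / z.im) * ‖lin z v‖ ^ 2) : ℂ) := by
  have hy := z.im_pos
  refine Summable.of_norm_bounded (summable_pow_mul_gauss z (a := π * t / z.im)
    (by positivity) d) (fun v => le_of_eq ?_)
  rw [norm_mul, norm_pow, RCLike.norm_conj, norm_real, Real.norm_of_nonneg (Real.exp_pos _).le]

/-- Expand the exponential and interchange sums. The norms sum over `j` to a Gaussian with a linear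
term in the exponent, which is still summable over the lattice. -/
lemma hasSum_thetaGen (z : ℍ) {t : ℝ} (ht : 0 < t) (α : ℂ) :
    HasSum (fun j : ℕ => α ^ j * (thetaCoeff z j t / j.factorial)) (thetaGen z t α) := by
  have hy := z.im_pos
  have hexp : ∀ w : ℂ, HasSum (fun j : ℕ => w ^ j / j.factorial) (cexp w) := by
    intro w
    rw [Complex.exp_eq_exp_ℂ]
    exact NormedSpace.expSeries_div_hasSum_exp w
  have hexpR : ∀ w : ℝ, HasSum (fun j : ℕ => w ^ j / j.factorial) (Real.exp w) := by
    intro w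
    rw [Real.exp_eq_exp_ℝ]
    exact NormedSpace.expSeries_div_hasSum_exp w
  set f : (Fin 2 → ℤ) × ℕ → ℂ := fun p =>
    (Real.exp (-(π * t / z.im) * ‖lin z p.1‖ ^ 2) : ℂ) *
      ((α * conj (lin z p.1)) ^ p.2 / p.2.factorial) with hf
  have hnorm : ∀ p, ‖f p‖ = Real.exp (-(π * t / z.im) * ‖lin z p.1‖ ^ 2) *
      ((‖α‖ * ‖lin z p.1‖) ^ p.2 / p.2.factorial) := by
    intro p
    simp only [hf]
    rw [norm_mul, norm_real, Real.norm_of_nonneg (Real.exp_pos _).le, norm_div, norm_pow, norm_mul,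
      RCLike.norm_conj, norm_natCast]
  have hsf : Summable f := by
    rw [← summable_norm_iff, summable_prod_of_nonneg (fun _ => norm_nonneg _)]
    simp only [hnorm]
    refine ⟨fun v => ((hexpR _).summable.mul_left _), ?_⟩
    refine (summable_exp_gauss z (a := π * t / z.im) (by positivity) ‖α‖).congr fun v => ?_
    rw [tsum_mul_left, (hexpR _).tsum_eq, ← Real.exp_add]
    congr 1
    ring
  have h1 : ∀ v, HasSum (fun j => f (v, j))
      (cexp (-(π * t / z.im * ‖lin z v‖ ^ 2 : ℝ) + α * conj (lin z v))) := by
    intro v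
    convert! (hexp (α * conj (lin z v))).mul_left
      (Real.exp (-(π * t / z.im) * ‖lin z v‖ ^ 2) : ℂ) using 1
    rw [ofReal_exp, ← Complex.exp_add]
    congr 2
    push_cast
    ring
  have h2 : ∀ j, HasSum (fun v => f (v, j)) (α ^ j * (thetaCoeff z j t / j.factorial)) := by
    intro j
    convert! (summable_thetaCoeff z j ht).hasSum.mul_left (α ^ j / j.factorial) using 1
    · ext v
      simp only [hf]
      ring
    · rw [thetaCoeff]; ring
  have h3 : HasSum f (thetaGen z t α) := by
    have := hsf.hasSum.prod_fiberwise h1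
    rw [thetaGen, this.tsum_eq]
    exact hsf.hasSum
  exact ((Equiv.prodComm _ _).hasSum_iff.mpr h3).prod_fiberwise h2

lemma coeff_eq_of_hasSum {a b : ℕ → ℂ} {f : ℂ → ℂ} (ha : ∀ α, HasSum (fun j => α ^ j * a j) (f α))
    (hb : ∀ α, HasSum (fun j => α ^ j * b j) (f α)) : a = b := by
  have key : ∀ c : ℕ → ℂ, (∀ α, HasSum (fun j => α ^ j * c j) (f α)) →
      HasFPowerSeriesAt f
        (fun n => ContinuousMultilinearMap.mkPiRing ℂ (Fin n) (c n) : FormalMultilinearSeries ℂ ℂ ℂ)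
        0 := by
    intro c hc
    refine hasFPowerSeriesAt_iff.mpr (Eventually.of_forall fun α => ?_)
    simpa [FormalMultilinearSeries.coeff] using hc α
  have h := (key a ha).eq_formalMultilinearSeries (key b hb)
  ext n
  have := congrArg (fun p : FormalMultilinearSeries ℂ ℂ ℂ => p.coeff n) h
  simpa [FormalMultilinearSeries.coeff] using this

/-- Compare the coefficients of `α ^ d` in the functional equation of the generating function:
rescaling `α` by `1/t` accounts for `t ^ d`, the automorphy factor for one more `t`. -/
lemma thetaCoeff_functional_equation (z : ℍ) (d : ℕ) {t : ℝ} (ht : 0 < t) :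
    thetaCoeff z d (1 / t) = t ^ (d + 1) * thetaCoeff z d t := by
  have ht' : (t : ℂ) ≠ 0 := by exact_mod_cast ht.ne'
  have h := coeff_eq_of_hasSum (f := fun α => thetaGen z (1 / t) (α / t))
    (a := fun j => (thetaCoeff z j (1 / t) / j.factorial) / t ^ j)
    (b := fun j => t * (thetaCoeff z j t / j.factorial)) (fun α => ?_) (fun α => ?_)
  · have := congrFun h d
    have hd : (d.factorial : ℂ) ≠ 0 := by exact_mod_cast d.factorial_ne_zero
    field_simp at this
    rw [this]
    ring
  · convert! hasSum_thetaGen z (one_div_pos.mpr ht) (α / t) using 1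
    ext j
    rw [div_pow]
    ring
  · simp only [thetaGen_functional_equation z ht]
    convert! (hasSum_thetaGen z ht α).mul_left (t : ℂ) using 1
    ext j
    ring

/-! ### The theta series of weight `|k| + 1` as a functional-equation pair -/

/-- The harmonic polynomial of degree `|k|` attached to the weight `k`. -/
noncomputable def harmPoly (k : ℤ) (w : ℂ) : ℂ :=
  if 0 ≤ k then conj w ^ k.natAbs else w ^ k.natAbs

lemma norm_harmPoly (k : ℤ) (w : ℂ) : ‖harmPoly k w‖ = ‖w‖ ^ k.natAbs := by
  rw [harmPoly]
  split_ifs <;> simp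

lemma harmPoly_zero_right {k : ℤ} (hk : k ≠ 0) : harmPoly k 0 = 0 := by
  have : k.natAbs ≠ 0 := by omega
  rw [harmPoly]
  split_ifs <;> simp [this]

lemma harmPoly_zero_left (w : ℂ) : harmPoly 0 w = 1 := by simp [harmPoly]

/-- On the unit circle inversion is conjugation; this dictates the choice between `w̄` and `w`
according to the sign of `k`. -/
lemma div_norm_zpow_neg (k : ℤ) {w : ℂ} (hw : w ≠ 0) :
    (w / (‖w‖ : ℂ)) ^ (-k) = harmPoly k w / (‖w‖ : ℂ) ^ k.natAbs := by
  have hn : (‖w‖ : ℂ) ≠ 0 := by exact_mod_cast (norm_pos_iff.mpr hw).ne'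
  have hc : w * conj w = (‖w‖ : ℂ) ^ 2 := by rw [mul_conj, normSq_eq_norm_sq]; push_cast; rfl
  have hi : (w / (‖w‖ : ℂ))⁻¹ = conj w / ‖w‖ := by
    rw [inv_div, div_eq_div_iff hw hn, mul_comm (conj w), hc]; ring
  rw [harmPoly]
  split_ifs with h
  · obtain ⟨n, rfl⟩ := Int.eq_ofNat_of_zero_le h
    rw [zpow_neg, ← inv_zpow, hi, zpow_natCast, div_pow]
    simp
  · obtain ⟨n, hn'⟩ := Int.eq_ofNat_of_zero_le (show 0 ≤ -k by omega)
    rw [hn', zpow_natCast, div_pow]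
    have : k.natAbs = n := by omega
    rw [this]

/-- The theta series of weight `|k| + 1` whose Mellin transform is the completed
Eisenstein series of weight `k`. -/
noncomputable def thetaWt (k : ℤ) (z : ℍ) (t : ℝ) : ℂ :=
  ∑' v : Fin 2 → ℤ, harmPoly k (lin z v) * Real.exp (-(π * t / z.im) * ‖lin z v‖ ^ 2)

lemma thetaWt_eq (k : ℤ) (z : ℍ) (t : ℝ) : thetaWt k z t =
    if 0 ≤ k then thetaCoeff z k.natAbs t else conj (thetaCoeff z k.natAbs t) := by
  rw [thetaWt, thetaCoeff]
  split_ifs with h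
  · simp only [harmPoly, if_pos h]
  · rw [Complex.conj_tsum]
    simp only [harmPoly, if_neg h, map_mul, map_pow, conj_conj, conj_ofReal]

lemma summable_thetaWt (k : ℤ) (z : ℍ) {t : ℝ} (ht : 0 < t) :
    Summable fun v : Fin 2 → ℤ =>
      harmPoly k (lin z v) * (Real.exp (-(π * t / z.im) * ‖lin z v‖ ^ 2) : ℂ) := by
  have hy := z.im_pos
  refine Summable.of_norm_bounded (summable_pow_mul_gauss z (a := π * t / z.im)
    (by positivity) k.natAbs) (fun v => le_of_eq ?_)
  rw [norm_mul, norm_harmPoly, norm_real, Real.norm_of_nonneg (Real.exp_pos _).le]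

lemma thetaWt_functional_equation (k : ℤ) (z : ℍ) {t : ℝ} (ht : 0 < t) :
    thetaWt k z (1 / t) = t ^ (k.natAbs + 1) * thetaWt k z t := by
  rw [thetaWt_eq, thetaWt_eq, thetaCoeff_functional_equation z _ ht]
  split_ifs
  · rfl
  · simp

lemma continuousOn_thetaWt (k : ℤ) (z : ℍ) : ContinuousOn (thetaWt k z) (Set.Ioi 0) := by
  have hy := z.im_pos
  intro t ht
  have ht : 0 < t := ht
  refine ContinuousAt.continuousWithinAt ?_
  have : ContinuousOn (thetaWt k z) (Set.Ioi (t / 2)) := by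
    unfold thetaWt
    refine continuousOn_tsum (fun v => by fun_prop)
      (summable_pow_mul_gauss z (a := π * (t / 2) / z.im) (by positivity) k.natAbs) ?_
    intro v s hs
    have hs : t / 2 < s := hs
    rw [norm_mul, norm_harmPoly, norm_real, Real.norm_of_nonneg (Real.exp_pos _).le]
    gcongr
  exact this.continuousAt (Ioi_mem_nhds (by linarith))

/-- The term at the origin of the theta series. -/
noncomputable def thetaConst (k : ℤ) : ℂ := if k = 0 then 1 else 0

lemma harmPoly_zero (k : ℤ) : harmPoly k 0 = thetaConst k := by
  rw [thetaConst]
  split_ifs with h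
  · rw [h, harmPoly_zero_left]
  · exact harmPoly_zero_right h

lemma hasSum_thetaWt_sub (k : ℤ) (z : ℍ) {t : ℝ} (ht : 0 < t) :
    HasSum (fun v : Fin 2 → ℤ => (if v = 0 then 0 else harmPoly k (lin z v)) *
      (Real.exp (-(π * t / z.im) * ‖lin z v‖ ^ 2) : ℂ)) (thetaWt k z t - thetaConst k) := by
  have h := (summable_thetaWt k z ht).hasSum.sub (hasSum_ite_eq (0 : Fin 2 → ℤ) (thetaConst k))
  convert! h using 1
  ext v
  by_cases hv : v = 0
  · simp [hv, harmPoly_zero]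
  · simp [hv]

/-- Nonzero lattice vectors are bounded below in norm, so for `t ≥ 1` a factor `exp(-c(t - 1))`
splits off and the convergent series at `t = 1` remains as a bound. -/
lemma thetaWt_isBigO (k : ℤ) (z : ℍ) (r : ℝ) :
    (fun t => thetaWt k z t - thetaConst k) =O[atTop] (fun t : ℝ => t ^ r) := by
  have hy := z.im_pos
  have hr := EisensteinSeries.r_pos z
  set ρ := EisensteinSeries.r z
  set c : ℝ := π / z.im * ρ ^ 2 with hc
  have hc0 : 0 < c := by positivity
  set C : ℝ := ∑' v : Fin 2 → ℤ, ‖lin z v‖ ^ k.natAbs * Real.exp (-(π / z.im) * ‖lin z v‖ ^ 2)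
  have hsC : Summable fun v : Fin 2 → ℤ =>
      ‖lin z v‖ ^ k.natAbs * Real.exp (-(π / z.im) * ‖lin z v‖ ^ 2) :=
    summable_pow_mul_gauss z (by positivity) _
  refine Asymptotics.IsBigO.trans ?_ (isLittleO_exp_neg_mul_rpow_atTop hc0 r).isBigO
  refine Asymptotics.IsBigO.of_bound (Real.exp c * C) ?_
  filter_upwards [eventually_ge_atTop 1] with t ht
  have ht0 : 0 < t := by linarith
  rw [← (hasSum_thetaWt_sub k z ht0).tsum_eq, Real.norm_of_nonneg (Real.exp_pos _).le,
    mul_right_comm]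
  refine tsum_of_norm_bounded (hsC.hasSum.mul_left _) fun v => ?_
  by_cases hv : v = 0
  · simp only [hv, if_true, zero_mul, norm_zero]
    positivity
  · rw [if_neg hv, norm_mul, norm_harmPoly, norm_real, Real.norm_of_nonneg (Real.exp_pos _).le,
      mul_left_comm, ← Real.exp_add, ← Real.exp_add]
    gcongr
    have h1 : ρ ^ 2 ≤ ‖lin z v‖ ^ 2 := pow_le_pow_left₀ hr.le (r_le_norm_lin z hv) 2
    have h2 : 0 ≤ (t - 1) * (π / z.im) * (‖lin z v‖ ^ 2 - ρ ^ 2) :=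
      mul_nonneg (mul_nonneg (by linarith) (by positivity)) (by linarith)
    rw [hc]
    have h3 : -(π * t / z.im) = -(π / z.im) * t := by ring
    rw [h3]
    nlinarith

/-- The functional-equation pair of the weight `k` theta series. -/
noncomputable def eisPair (k : ℤ) (z : ℍ) : WeakFEPair ℂ where
  f := thetaWt k z
  g := thetaWt k z
  k := k.natAbs + 1
  ε := 1
  f₀ := thetaConst k
  g₀ := thetaConst k
  hf_int := (continuousOn_thetaWt k z).locallyIntegrableOn measurableSet_Ioi
  hg_int := (continuousOn_thetaWt k z).locallyIntegrableOn measurableSet_Ioi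
  hk := by positivity
  hε := one_ne_zero
  h_feq t ht := by
    rw [thetaWt_functional_equation k z ht, smul_eq_mul, one_mul]
    norm_cast
  hf_top := thetaWt_isBigO k z
  hg_top := thetaWt_isBigO k z

/-! ### The Mellin transform as a lattice sum -/

/-- The summand `(w / |w|) ^ (-k) (y / |w|²) ^ s` at `w = v₀ z + v₁`. -/
noncomputable def latTerm (k : ℤ) (z : ℍ) (s : ℂ) (v : Fin 2 → ℤ) : ℂ :=
  (lin z v / (‖lin z v‖ : ℂ)) ^ (-k) * ((z.im / ‖lin z v‖ ^ 2 : ℝ) : ℂ) ^ s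

/-- Since `y / 0 = 0` and `0 ^ s = 0`, the origin may stay in the lattice sums. -/
lemma latTerm_zero (k : ℤ) (z : ℍ) {s : ℂ} (hs : s ≠ 0) : latTerm k z s 0 = 0 := by
  simp [latTerm, hs]

lemma norm_latTerm (k : ℤ) (z : ℍ) (s : ℂ) {v : Fin 2 → ℤ} (hv : v ≠ 0) :
    ‖latTerm k z s v‖ = z.im ^ s.re * ‖lin z v‖ ^ (-(2 * s.re)) := by
  have hy := z.im_pos
  have hw : 0 < ‖lin z v‖ := norm_pos_iff.mpr (lin_ne_zero z hv)
  rw [latTerm, norm_mul, norm_zpow, norm_div, norm_real, norm_norm, div_self hw.ne', one_zpow,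
    one_mul, norm_cpow_eq_rpow_re_of_pos (by positivity), Real.div_rpow hy.le (by positivity),
    Real.rpow_neg hw.le, ← Real.rpow_natCast, ← Real.rpow_mul hw.le]
  rfl

lemma summable_norm_latTerm (k : ℤ) (z : ℍ) {s : ℂ} (hs : 1 < s.re) :
    Summable fun v => ‖latTerm k z s v‖ := by
  refine Summable.of_nonneg_of_le (fun _ => norm_nonneg _) (fun v => ?_)
    ((summable_norm_lin_rpow z (p := 2 * s.re) (by linarith)).mul_left (z.im ^ s.re))
  by_cases hv : v = 0
  · have : s ≠ 0 := by rintro rfl; norm_num at hs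
    rw [hv, latTerm_zero k z this, norm_zero]
    have := z.im_pos
    positivity
  · exact (norm_latTerm k z s hv).le

/-- Integrate termwise. The shift by `|k|/2` compensates the size `|w|^|k|` of the polynomial
coefficient. -/
lemma Lambda_eisPair {k : ℤ} (hk : Even k) (z : ℍ) {s : ℂ} (hs : 1 < s.re) :
    (eisPair k z).Λ (s + (k.natAbs / 2 : ℕ)) = (π : ℂ) ^ (-(s + (k.natAbs / 2 : ℕ))) *
      Gamma (s + (k.natAbs / 2 : ℕ)) * z.im ^ (k.natAbs / 2 : ℕ) * ∑' v, latTerm k z s v := by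
  have hy := z.im_pos
  set K := k.natAbs / 2 with hK
  have h2K : k.natAbs = 2 * K := by
    have := Int.natAbs_even.mpr hk
    obtain ⟨m, hm⟩ := this
    omega
  have hKre : ((K : ℕ) : ℂ).re = K := natCast_re K
  have hs0 : s ≠ 0 := by rintro rfl; norm_num at hs
  have hq : ∀ v : Fin 2 → ℤ, v ≠ 0 → 0 < ‖lin z v‖ ^ 2 / z.im := fun v hv => by
    have : 0 < ‖lin z v‖ := norm_pos_iff.mpr (lin_ne_zero z hv)
    positivity
  have hterm : ∀ v : Fin 2 → ℤ, (if v = 0 then 0 else harmPoly k (lin z v)) /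
      ((‖lin z v‖ ^ 2 / z.im : ℝ) : ℂ) ^ (s + K) = z.im ^ K * latTerm k z s v := by
    intro v
    by_cases hv : v = 0
    · rw [if_pos hv, hv, latTerm_zero k z hs0]
      simp
    · have hw := lin_ne_zero z hv
      have hn : (‖lin z v‖ : ℂ) ≠ 0 := by exact_mod_cast (norm_pos_iff.mpr hw).ne'
      have hy' : (z.im : ℂ) ≠ 0 := by exact_mod_cast hy.ne'
      have hq' : ((‖lin z v‖ ^ 2 / z.im : ℝ) : ℂ) ≠ 0 := by exact_mod_cast (hq v hv).ne'
      rw [if_neg hv, latTerm, div_norm_zpow_neg k hw, cpow_add _ _ hq', cpow_natCast,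
        ← inv_div (‖lin z v‖ ^ 2), ofReal_inv, inv_cpow _ _ (by
          rw [arg_ofReal_of_nonneg (hq v hv).le]; exact Real.pi_pos.ne), h2K]
      have hq'' := (cpow_ne_zero_iff_of_exponent_ne_zero hs0).mpr hq'
      generalize ((‖lin z v‖ ^ 2 / z.im : ℝ) : ℂ) ^ s = Q at *
      push_cast
      rw [div_pow, pow_mul]
      field_simp
  have hsum := hasSum_mellin_pi_mul (ι := Fin 2 → ℤ) (s := s + K)
    (a := fun v => if v = 0 then 0 else harmPoly k (lin z v))
    (q := fun v => ‖lin z v‖ ^ 2 / z.im)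
    (F := fun t => thetaWt k z t - thetaConst k) ?_ ?_ ?_ ?_
  -- For `k = 0` the constant term is removed and `Re s > 1` is needed; for `k ≠ 0` there is no
  -- constant term and the pair is strong.
  · have hm : (eisPair k z).Λ (s + K) = mellin (fun t => thetaWt k z t - thetaConst k) (s + K) := by
      by_cases h0 : k = 0
      · refine ((eisPair k z).hasMellin (s := s + K) ?_).2.symm
        subst h0
        simpa [eisPair, hK] using hs
      · have hst : IsStrongFEPair (eisPair k z) :=
          ⟨by simp [eisPair, thetaConst, h0], by simp [eisPair, thetaConst, h0]⟩
        rw [hst.Λ_eq]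
        simp [eisPair, thetaConst, h0]
    rw [hm, ← hsum.tsum_eq, ← tsum_mul_left]
    refine tsum_congr fun v => ?_
    rw [mul_div_assoc, hterm v]
    ring
  · intro v
    by_cases hv : v = 0
    · simp [hv]
    · exact Or.inr (hq v hv)
  · rw [add_re, hKre]; positivity
  · intro t ht
    convert! hasSum_thetaWt_sub k z ht using 5
    ring
  · refine ((summable_norm_latTerm k z hs).mul_left (z.im ^ K)).congr fun v => ?_
    have := congrArg norm (hterm v)
    rw [norm_mul, norm_pow, norm_real, Real.norm_of_nonneg hy.le] at this
    rw [← this, norm_div]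
    by_cases hv : v = 0
    · simp [hv]
    · rw [norm_cpow_eq_rpow_re_of_pos (hq v hv)]

end HarmonicEis

namespace HarmonicEis

open Complex Filter Topology EisensteinSeries
open scoped Real ComplexConjugate

/-! ### Cosets of `Γ_∞`, coprime pairs and the factor `ζ(2s)` -/

/-- The bottom row of a matrix. -/
def bottomRow (γ : SL(2, ℤ)) : Fin 2 → ℤ := ![γ 1 0, γ 1 1]

lemma j_eq_lin (γ : SL(2, ℤ)) (z : ℍ) : j γ z = lin z (bottomRow γ) := by
  simp [j, lin, bottomRow]

lemma bottomRow_mem (γ : SL(2, ℤ)) : bottomRow γ ∈ gammaSet 1 1 0 := by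
  rw [mem_gammaSet_one]
  exact ModularGroup.bottom_row_coprime γ

lemma ne_zero_of_mem_gammaSet {v : Fin 2 → ℤ} (hv : v ∈ gammaSet 1 1 0) : v ≠ 0 := by
  rintro rfl
  rw [mem_gammaSet_one] at hv
  exact not_isCoprime_zero_zero hv

lemma eisTerm_eq_latTerm (k : ℤ) (z : ℍ) (s : ℂ) (γ : SL(2, ℤ)) :
    eisTerm k z s γ = latTerm k z s (bottomRow γ) := by
  rw [eisTerm, latTerm, j_eq_lin]
  congr 3
  rw [ModularGroup.im_smul_eq_div_normSq, ModularGroup.denom_apply, normSq_eq_norm_sq]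
  simp [lin, bottomRow]

lemma latTerm_neg {k : ℤ} (hk : Even k) (z : ℍ) (s : ℂ) (v : Fin 2 → ℤ) :
    latTerm k z s (-v) = latTerm k z s v := by
  have h : lin z (-v) = -lin z v := by simp [lin]; ring
  rw [latTerm, h, norm_neg, neg_div, hk.neg.neg_zpow, latTerm]

lemma latTerm_smul (k : ℤ) (z : ℍ) {s : ℂ} {n : ℕ} (hn : n ≠ 0) (v : Fin 2 → ℤ) :
    latTerm k z s ((n : ℤ) • v) = 1 / (n : ℂ) ^ (2 * s) * latTerm k z s v := by
  have h : lin z ((n : ℤ) • v) = n * lin z v := by simp [lin]; ring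
  have hn' : (n : ℂ) ≠ 0 := by exact_mod_cast hn
  have hy := z.im_pos
  rw [latTerm, h, norm_mul, norm_natCast, ofReal_mul, ofReal_natCast,
    mul_div_mul_left _ _ hn', latTerm, mul_left_comm]
  congr 1
  rw [mul_pow, ← div_div, div_right_comm, div_eq_mul_one_div _ ((n : ℝ) ^ 2), ofReal_mul,
    mul_cpow_ofReal_nonneg (by positivity) (by positivity), mul_comm]
  congr 1
  rw [one_div, ofReal_inv, inv_cpow _ _ (by
    rw [arg_ofReal_of_nonneg (by positivity)]; exact Real.pi_pos.ne), ofReal_pow, ofReal_natCast,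
    one_div, ← cpow_nat_mul' (by simp [Real.pi_pos]) (by simp [Real.pi_pos.le])]
  simp

lemma mem_GammaInf_of_lower_left_eq_zero {g : SL(2, ℤ)} (hc : g 1 0 = 0) : g ∈ GammaInf := by
  have had := g.det_coe
  replace had : g 0 0 * g 1 1 = 1 := by
    rw [Matrix.det_fin_two, hc] at had; linarith
  rcases Int.eq_one_or_neg_one_of_mul_eq_one' had with (⟨ha, hd⟩ | ⟨ha, hd⟩)
  · refine ⟨g 0 1, Or.inl ?_⟩
    ext i j
    fin_cases i <;> fin_cases j <;> simp [ha, hc, hd, ModularGroup.coe_T_zpow]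
  · refine ⟨-g 0 1, Or.inr ?_⟩
    ext i j
    fin_cases i <;> fin_cases j <;> simp [ha, hc, hd, ModularGroup.coe_T_zpow]

lemma mul_inv_mem_GammaInf {γ δ : SL(2, ℤ)} (u : ℤ) (h : bottomRow γ = u • bottomRow δ) :
    γ * δ⁻¹ ∈ GammaInf := by
  apply mem_GammaInf_of_lower_left_eq_zero
  have h0 := congrFun h 0
  have h1 := congrFun h 1
  simp [bottomRow] at h0 h1
  simp [Matrix.SpecialLinearGroup.coe_mul, Matrix.SpecialLinearGroup.coe_inv, Matrix.mul_apply,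
    Fin.sum_univ_two, Matrix.adjugate_fin_two]
  rw [h0, h1]
  ring

/-- Cosets of `GammaInf` together with a sign, seen as coprime pairs. -/
noncomputable def cosetRow (p : Quotient (QuotientGroup.rightRel GammaInf) × ℤˣ) : gammaSet 1 1 0 :=
  ⟨(p.2 : ℤ) • bottomRow p.1.out, by
    have h := bottomRow_mem p.1.out
    rw [mem_gammaSet_one] at h ⊢
    rcases Int.units_eq_one_or p.2 with hu | hu <;> rw [hu]
    · simpa using h
    · simpa using h.neg_neg⟩

/-- Every coprime pair is a bottom row. Matrices whose bottom rows agree up to sign differ by a left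
factor with lower left entry `0`, that is, by an element of `Γ_∞`; the sign is then determined
because the row is nonzero. -/
lemma cosetRow_bijective : Function.Bijective cosetRow := by
  constructor
  · rintro ⟨c, u⟩ ⟨c', u'⟩ h
    have h' : (u : ℤ) • bottomRow c.out = (u' : ℤ) • bottomRow c'.out := congrArg Subtype.val h
    have h2 : bottomRow c'.out = ((u' * u : ℤˣ) : ℤ) • bottomRow c.out := by
      rw [Units.val_mul, mul_smul, h', ← mul_smul, ← Units.val_mul, Int.units_mul_self]
      simp
    have hc : c = c' := by
      rw [← c.out_eq, ← c'.out_eq]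
      exact Quotient.sound (QuotientGroup.rightRel_apply.mpr (mul_inv_mem_GammaInf _ h2))
    subst hc
    have hne := ne_zero_of_mem_gammaSet (bottomRow_mem c.out)
    have hu : (u : ℤ) = u' := smul_left_injective ℤ hne h'
    rw [Units.ext hu]
  · rintro ⟨v, hv⟩
    obtain ⟨g, -, hg⟩ := ModularGroup.bottom_row_surj (R := ℤ) ((mem_gammaSet_one v).mp hv)
    have hg' : bottomRow g = v := by
      rw [← hg]
      ext i
      fin_cases i <;> rfl
    set c : Quotient (QuotientGroup.rightRel GammaInf) := Quotient.mk _ g with hc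
    have hrel : g * (c.out)⁻¹ ∈ GammaInf :=
      QuotientGroup.rightRel_apply.mp (Quotient.exact c.out_eq)
    obtain ⟨n, hn⟩ := hrel
    have hrow : ∀ δ : SL(2, ℤ), bottomRow (ModularGroup.T ^ n * δ) = bottomRow δ := by
      intro δ
      simp [bottomRow]
    have hneg : ∀ δ : SL(2, ℤ), bottomRow (-δ) = -bottomRow δ := by
      intro δ
      simp [bottomRow]
    rcases hn with hn | hn
    · refine ⟨(c, 1), Subtype.ext ?_⟩
      rw [mul_inv_eq_iff_eq_mul] at hn
      change ((1 : ℤˣ) : ℤ) • bottomRow c.out = v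
      rw [← hg', hn, hrow]
      simp
    · refine ⟨(c, -1), Subtype.ext ?_⟩
      rw [mul_inv_eq_iff_eq_mul, neg_mul] at hn
      change ((-1 : ℤˣ) : ℤ) • bottomRow c.out = v
      rw [← hg', hn, hneg, hrow]
      simp

lemma tsum_gammaSet_eq {k : ℤ} (hk : Even k) (z : ℍ) {s : ℂ} (hs : 1 < s.re) :
    ∑' v : gammaSet 1 1 0, latTerm k z s v = 2 * eisSeries k z s := by
  have hsum : Summable fun v : gammaSet 1 1 0 => latTerm k z s v :=
    ((summable_norm_latTerm k z hs).of_norm).subtype _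
  have hs' := (Equiv.ofBijective _ cosetRow_bijective).summable_iff.mpr hsum
  have hterm : ∀ p, latTerm k z s (cosetRow p) = eisTerm k z s p.1.out := by
    rintro ⟨c, u⟩
    rw [eisTerm_eq_latTerm]
    change latTerm k z s ((u : ℤ) • bottomRow c.out) = _
    rcases Int.units_eq_one_or u with hu | hu <;> rw [hu]
    · simp
    · simp [latTerm_neg hk]
  rw [← (Equiv.ofBijective _ cosetRow_bijective).tsum_eq]
  change Summable (fun p => latTerm k z s (cosetRow p)) at hs'
  change ∑' p, latTerm k z s (cosetRow p) = _
  simp only [hterm] at hs' ⊢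
  rw [hs'.tsum_prod, eisSeries, ← tsum_mul_left]
  refine tsum_congr fun c => ?_
  rw [tsum_fintype]
  simp

lemma summable_eisTerm (k : ℤ) (z : ℍ) {s : ℂ} (hs : 1 < s.re) :
    Summable fun c : Quotient (QuotientGroup.rightRel GammaInf) => eisTerm k z s c.out := by
  have hinj : Function.Injective fun c : Quotient (QuotientGroup.rightRel GammaInf) =>
      bottomRow c.out := by
    intro c c' h
    have h' : cosetRow (c, 1) = cosetRow (c', 1) := Subtype.ext (by simpa [cosetRow] using h)
    exact congrArg Prod.fst (cosetRow_bijective.1 h')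
  simp only [eisTerm_eq_latTerm]
  exact ((summable_norm_latTerm k z hs).of_norm).comp_injective hinj

/-- Sort the lattice vectors by their gcd `n`: dividing it out contributes `n ^ (-2s)` and leaves a
coprime pair. The class `n = 0` is the origin, where both sides vanish. -/
lemma tsum_latTerm {k : ℤ} (hk : Even k) (z : ℍ) {s : ℂ} (hs : 1 < s.re) :
    ∑' v, latTerm k z s v = 2 * riemannZeta (2 * s) * eisSeries k z s := by
  have hsum := summable_norm_latTerm k z hs
  have hs0 : s ≠ 0 := by rintro rfl; norm_num at hs
  have h2s : 1 < (2 * s).re := by simp; linarith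
  rw [mul_comm 2, mul_assoc, ← tsum_gammaSet_eq hk z hs, zeta_eq_tsum_one_div_nat_cpow h2s,
    ← gammaSetDivGcdSigmaEquiv.symm.tsum_eq]
  simp_rw [gammaSetDivGcdSigmaEquiv_symm_eq]
  have hsig : Summable fun c : (Σ r : ℕ, gammaSet 1 r 0) => latTerm k z s c.2 :=
    (gammaSetDivGcdSigmaEquiv.symm.summable_iff.mpr hsum.of_norm).congr fun c => by
      rw [Function.comp_apply, gammaSetDivGcdSigmaEquiv_symm_eq]
  rw [hsig.tsum_sigma, ← tsum_mul_right]
  refine tsum_congr fun n => ?_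
  rcases eq_or_ne n 0 with rfl | hn
  · have : ∀ v : gammaSet 1 0 0, latTerm k z s v = 0 := by
      rintro ⟨v, hv⟩
      rw [gammaSet_one_mem_iff, Int.gcd_eq_zero_iff] at hv
      have : v = 0 := by ext i; fin_cases i; exacts [hv.1, hv.2]
      change latTerm k z s v = 0
      rw [this, latTerm_zero k z hs0]
    have h20 : 2 * s ≠ 0 := by simpa using hs0
    simp [this, h20]
  · have : NeZero n := ⟨hn⟩
    rw [← (gammaSetDivGcdEquiv n).tsum_eq, ← tsum_mul_left]
    refine tsum_congr fun v => ?_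
    rw [gammaSetDivGcdEquiv_eq, ← latTerm_smul k z hn]
    congr 1
    have := gammaSet_eq_gcd_mul_divIntMap v.2
    simpa using this

/-! ### The function `θ_k` off its possible poles -/

lemma toMeromorphicNFOn_eventuallyEq_of_analyticAt {f g : ℂ → ℂ} {s : ℂ}
    (hf : MeromorphicOn f Set.univ) (hfg : f =ᶠ[𝓝[≠] s] g) (hg : AnalyticAt ℂ g s) :
    toMeromorphicNFOn f Set.univ =ᶠ[𝓝 s] g := by
  have h1 : toMeromorphicNFOn f Set.univ =ᶠ[𝓝[≠] s] g :=
    (hf.toMeromorphicNFOn_eq_self_on_nhdsNE (Set.mem_univ s)).trans hfg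
  exact ((meromorphicNFOn_toMeromorphicNFOn f Set.univ
    (Set.mem_univ s)).eventuallyEq_nhdsNE_iff_eventuallyEq_nhds hg.meromorphicNFAt).mp h1

/-- `θ_k` written with the completed zeta function. -/
noncomputable def thetaZeta (k : ℤ) (s : ℂ) : ℂ :=
  completedRiemannZeta (2 * s) * ∏ i ∈ Finset.range (k.natAbs / 2), (s + (i : ℂ))

lemma pi_cpow_mul_Gamma_mul_zeta {s : ℂ} (hs : ∀ n : ℕ, s ≠ -n) :
    (π : ℂ) ^ (-s) * Gamma s * riemannZeta (2 * s) = completedRiemannZeta (2 * s) := by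
  have h0 : 2 * s ≠ 0 := by simpa using hs 0
  have h1 : Gammaℝ (2 * s) = (π : ℂ) ^ (-s) * Gamma s := by
    rw [Gammaℝ_def]
    congr 2 <;> ring
  have h2 : Gammaℝ (2 * s) ≠ 0 := by
    rw [Ne, Gammaℝ_eq_zero_iff]
    rintro ⟨n, hn⟩
    exact hs n (by linear_combination hn / 2)
  rw [riemannZeta_def_of_ne_zero h0, ← h1, mul_div_cancel₀ _ h2]

/-- The points `-n` are zeros of the entire function `1/Γ`, hence isolated. -/
lemma eventually_nhdsNE_ne_neg_nat (s : ℂ) : ∀ᶠ t in 𝓝[≠] s, ∀ n : ℕ, t ≠ -(n : ℂ) := by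
  have han : AnalyticOnNhd ℂ (fun t : ℂ => (Gamma t)⁻¹) Set.univ :=
    (differentiable_one_div_Gamma.differentiableOn).analyticOnNhd isOpen_univ
  rcases (han s (Set.mem_univ s)).eventually_eq_zero_or_eventually_ne_zero with h | h
  · exfalso
    have := han.eqOn_zero_of_preconnected_of_eventuallyEq_zero isPreconnected_univ
      (Set.mem_univ s) h (Set.mem_univ 1)
    simp at this
  · filter_upwards [h] with t ht n hn
    apply ht
    rw [hn, Gamma_neg_nat_eq_zero, inv_zero]

lemma thetaRaw_eventuallyEq (k : ℤ) (s : ℂ) :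
    (fun s : ℂ => (π : ℂ) ^ (-s) * Gamma s * riemannZeta (2 * s) *
      ∏ i ∈ Finset.range (k.natAbs / 2), (s + (i : ℂ))) =ᶠ[𝓝[≠] s] thetaZeta k := by
  filter_upwards [eventually_nhdsNE_ne_neg_nat s] with t ht
  rw [thetaZeta, pi_cpow_mul_Gamma_mul_zeta ht]

lemma analyticAt_completedRiemannZeta {s : ℂ} (h0 : s ≠ 0) (h1 : s ≠ 1) :
    AnalyticAt ℂ completedRiemannZeta s := by
  rw [analyticAt_iff_eventually_differentiableAt]
  filter_upwards [isOpen_ne.mem_nhds h0, isOpen_ne.mem_nhds h1] with t ht0 ht1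
  exact differentiableAt_completedZeta ht0 ht1

lemma analyticAt_thetaZeta (k : ℤ) {s : ℂ} (h0 : s ≠ 0) (h1 : s ≠ 1 / 2) :
    AnalyticAt ℂ (thetaZeta k) s := by
  refine AnalyticAt.mul ?_ ?_
  · refine AnalyticAt.fun_comp (g := completedRiemannZeta) (f := fun s => 2 * s) ?_ (by fun_prop)
    refine analyticAt_completedRiemannZeta (by simpa using h0) fun h => h1 ?_
    linear_combination h / 2
  · have : Differentiable ℂ fun s : ℂ => ∏ i ∈ Finset.range (k.natAbs / 2), (s + (i : ℂ)) := by
      fun_prop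
    exact this.analyticAt s

lemma meromorphicAt_thetaZeta (k : ℤ) (s : ℂ) : MeromorphicAt (thetaZeta k) s := by
  by_cases h : s ≠ 0 ∧ s ≠ 1 / 2
  · exact (analyticAt_thetaZeta k h.1 h.2).meromorphicAt
  have h1 : MeromorphicAt (fun s => completedRiemannZeta (2 * s)) s := by
    have h : (fun s => completedRiemannZeta (2 * s)) =
        fun s => completedRiemannZeta₀ (2 * s) - 1 / (2 * s) - 1 / (1 - 2 * s) := by
      ext s; exact completedRiemannZeta_eq _
    rw [h]
    have h0 : MeromorphicAt (fun s => completedRiemannZeta₀ (2 * s)) s :=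
      ((differentiable_completedZeta₀.comp (by fun_prop : Differentiable ℂ fun s : ℂ => 2 * s)
        ).analyticAt s).meromorphicAt
    fun_prop
  refine h1.mul ?_
  have : Differentiable ℂ fun s : ℂ => ∏ i ∈ Finset.range (k.natAbs / 2), (s + (i : ℂ)) := by
    fun_prop
  exact (this.analyticAt s).meromorphicAt

lemma thetaK_eventuallyEq (k : ℤ) {s : ℂ} (h0 : s ≠ 0) (h1 : s ≠ 1 / 2) :
    thetaK k =ᶠ[𝓝 s] thetaZeta k :=
  toMeromorphicNFOn_eventuallyEq_of_analyticAt
    (fun t _ => (meromorphicAt_thetaZeta k t).congr (thetaRaw_eventuallyEq k t).symm)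
    (thetaRaw_eventuallyEq k s) (analyticAt_thetaZeta k h0 h1)

lemma analyticAt_thetaK (k : ℤ) {s : ℂ} (h0 : s ≠ 0) (h1 : s ≠ 1 / 2) :
    AnalyticAt ℂ (thetaK k) s :=
  (analyticAt_thetaZeta k h0 h1).congr (thetaK_eventuallyEq k h0 h1).symm

lemma thetaK_eq_thetaZeta (k : ℤ) {s : ℂ} (h0 : s ≠ 0) (h1 : s ≠ 1 / 2) :
    thetaK k s = thetaZeta k s :=
  (thetaK_eventuallyEq k h0 h1).eq_of_nhds

lemma Gamma_add_nat (s : ℂ) (hs : ∀ n : ℕ, s ≠ -n) (n : ℕ) :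
    Gamma (s + n) = Gamma s * ∏ i ∈ Finset.range n, (s + (i : ℂ)) := by
  induction n with
  | zero => simp
  | succ n ih =>
    have : s + n ≠ 0 := fun h => hs n (eq_neg_of_add_eq_zero_left h)
    rw [Nat.cast_succ, ← add_assoc, Gamma_add_one _ this, ih, Finset.prod_range_succ]
    ring

lemma thetaK_of_one_half_lt_re (k : ℤ) {s : ℂ} (hs : 1 / 2 < s.re) :
    thetaK k s = (π : ℂ) ^ (-s) * Gamma (s + (k.natAbs / 2 : ℕ)) * riemannZeta (2 * s) := by
  have hn : ∀ n : ℕ, s ≠ -n := by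
    rintro n rfl
    simp at hs
    have : (0 : ℝ) ≤ n := n.cast_nonneg
    norm_num at hs
    linarith
  have h1 : s ≠ 1 / 2 := by rintro rfl; norm_num at hs
  rw [thetaK_eq_thetaZeta k (by simpa using hn 0) h1, thetaZeta, ← pi_cpow_mul_Gamma_mul_zeta hn,
    Gamma_add_nat s hn]
  ring

/-! ### Continuation and functional equation of `E*_k` -/

/-- The completed Eisenstein series, away from its poles. -/
noncomputable def eisLambda (k : ℤ) (z : ℍ) (s : ℂ) : ℂ :=
  1 / 2 * ((π : ℂ) / z.im) ^ (k.natAbs / 2) * (eisPair k z).Λ (s + (k.natAbs / 2 : ℕ))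

lemma eisLambda_of_one_lt_re {k : ℤ} (hk : Even k) (z : ℍ) {s : ℂ} (hs : 1 < s.re) :
    eisLambda k z s = 1 / 2 * (π : ℂ) ^ (-s) * Gamma (s + (k.natAbs / 2 : ℕ)) *
      ∑' v, latTerm k z s v := by
  have hy : (z.im : ℂ) ≠ 0 := by exact_mod_cast z.im_pos.ne'
  have hpi : (π : ℂ) ≠ 0 := by exact_mod_cast Real.pi_ne_zero
  rw [eisLambda, Lambda_eisPair hk z hs, neg_add, cpow_add _ _ hpi, cpow_neg _ (k.natAbs / 2 : ℕ),
    cpow_natCast, div_pow]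
  field_simp

lemma eisLambda_eq_thetaK_mul {k : ℤ} (hk : Even k) (z : ℍ) {s : ℂ} (hs : 1 < s.re) :
    eisLambda k z s = thetaK k s * eisSeries k z s := by
  rw [eisLambda_of_one_lt_re hk z hs, tsum_latTerm hk z hs,
    thetaK_of_one_half_lt_re k (by linarith)]
  ring

/-- Poles of the Mellin transform come only from the constant term of the theta series, which is
zero for `k ≠ 0`. -/
lemma analyticAt_eisLambda (k : ℤ) (z : ℍ) {s : ℂ} (h : k ≠ 0 ∨ s ≠ 0 ∧ s ≠ 1) :
    AnalyticAt ℂ (eisLambda k z) s := by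
  have hdiff : ∀ t : ℂ, (k ≠ 0 ∨ t ≠ 0 ∧ t ≠ 1) → DifferentiableAt ℂ (eisLambda k z) t := by
    intro t ht
    refine DifferentiableAt.const_mul ?_ _
    have : DifferentiableAt ℂ (eisPair k z).Λ (t + (k.natAbs / 2 : ℕ)) := by
      by_cases h0 : k = 0
      · have h2 : t ≠ 0 ∧ t ≠ 1 := ht.resolve_left (not_not.mpr h0)
        have h3 : t + (k.natAbs / 2 : ℕ) = t := by simp [h0]
        rw [h3]
        refine (eisPair k z).differentiableAt_Λ (Or.inl h2.1) (Or.inl ?_)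
        simpa [eisPair, h0] using h2.2
      · exact (eisPair k z).differentiableAt_Λ (Or.inr (by simp [eisPair, thetaConst, h0]))
          (Or.inr (by simp [eisPair, thetaConst, h0]))
    exact this.comp t (by fun_prop : DifferentiableAt ℂ (fun t : ℂ => t + (k.natAbs / 2 : ℕ)) t)
  rw [analyticAt_iff_eventually_differentiableAt]
  rcases h with h | h
  · exact Eventually.of_forall fun t => hdiff t (Or.inl h)
  · filter_upwards [isOpen_ne.mem_nhds h.1, isOpen_ne.mem_nhds h.2] with t h0 h1
    exact hdiff t (Or.inr ⟨h0, h1⟩)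

lemma meromorphicOn_eisLambda (k : ℤ) (z : ℍ) : MeromorphicOn (eisLambda k z) Set.univ := by
  intro s _
  have h0 : MeromorphicAt (fun s : ℂ => (eisPair k z).Λ₀ (s + (k.natAbs / 2 : ℕ))) s :=
    (((eisPair k z).differentiable_Λ₀.comp
      (by fun_prop : Differentiable ℂ fun t : ℂ => t + (k.natAbs / 2 : ℕ))).analyticAt
        s).meromorphicAt
  unfold eisLambda
  simp only [WeakFEPair.Λ, smul_eq_mul]
  fun_prop

lemma isCompletedEis_toMeromorphicNFOn {k : ℤ} (hk : Even k) (z : ℍ) :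
    IsCompletedEis k z (toMeromorphicNFOn (eisLambda k z) Set.univ) := by
  refine ⟨meromorphicNFOn_toMeromorphicNFOn _ _, fun s hs => ?_⟩
  rw [← eisLambda_eq_thetaK_mul hk z hs]
  refine (toMeromorphicNFOn_eventuallyEq_of_analyticAt (meromorphicOn_eisLambda k z)
    EventuallyEq.rfl (analyticAt_eisLambda k z (Or.inr ⟨?_, ?_⟩))).eq_of_nhds
  · rintro rfl; norm_num at hs
  · rintro rfl; norm_num at hs

lemma isCompletedEis_completedEis {k : ℤ} (hk : Even k) (z : ℍ) :
    IsCompletedEis k z (completedEis k z) := by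
  have h : ∃ F, IsCompletedEis k z F := ⟨_, isCompletedEis_toMeromorphicNFOn hk z⟩
  rw [completedEis, dif_pos h]
  exact h.choose_spec

lemma completedEis_eventuallyEq {k : ℤ} (hk : Even k) (z : ℍ) {s : ℂ}
    (h : k ≠ 0 ∨ s ≠ 0 ∧ s ≠ 1) : completedEis k z =ᶠ[𝓝 s] eisLambda k z := by
  rw [(isCompletedEis_completedEis hk z).unique (isCompletedEis_toMeromorphicNFOn hk z)]
  exact toMeromorphicNFOn_eventuallyEq_of_analyticAt (meromorphicOn_eisLambda k z)
    EventuallyEq.rfl (analyticAt_eisLambda k z h)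

/-- The pair is its own dual, with reflection `s ↦ |k| + 1 - s`; the shift by `|k|/2` centres this
to `s ↦ 1 - s`. -/
lemma eisLambda_one_sub {k : ℤ} (hk : Even k) (z : ℍ) (s : ℂ) :
    eisLambda k z (1 - s) = eisLambda k z s := by
  have h2K : k.natAbs = 2 * (k.natAbs / 2) := by
    obtain ⟨m, hm⟩ := Int.natAbs_even.mpr hk
    omega
  have h := (eisPair k z).functional_equation (s + (k.natAbs / 2 : ℕ))
  have hsymm : (eisPair k z).symm = eisPair k z := by
    simp [WeakFEPair.symm, eisPair]
  rw [hsymm] at h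
  rw [eisLambda, eisLambda, show (1 - s + (k.natAbs / 2 : ℕ) : ℂ) =
    (eisPair k z).k - (s + (k.natAbs / 2 : ℕ)) from ?_, h]
  · simp [eisPair]
  · have : (((eisPair k z).k : ℝ) : ℂ) = 2 * ((k.natAbs / 2 : ℕ) : ℂ) + 1 := by
      simp only [eisPair]
      rw [h2K]
      push_cast
      simp
    rw [this]
    ring

/-! ### Weight zero -/

/-- Numerator and denominator have simple poles at `0`, both with residue `-1/2`. -/
lemma tendsto_completedEis_div_thetaK_zero (z : ℍ) :
    Tendsto (fun s : ℂ => completedEis 0 z s / thetaK 0 s) (𝓝[≠] 0) (𝓝 1) := by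
  have h1 : Tendsto (fun s : ℂ => s * ((eisPair 0 z).Λ s)) (𝓝[≠] 0) (𝓝 (-1)) := by
    have := (eisPair 0 z).Λ_residue_zero
    simpa [eisPair, thetaConst] using this
  have h2 : Tendsto (fun s : ℂ => s * completedRiemannZeta (2 * s)) (𝓝[≠] 0) (𝓝 (-1 / 2)) := by
    have hc : ContinuousAt (fun s : ℂ => s * completedRiemannZeta₀ (2 * s) - 1 / 2 -
        s / (1 - 2 * s)) 0 := by
      have := differentiable_completedZeta₀.continuous
      refine ContinuousAt.sub (by fun_prop) (ContinuousAt.div (by fun_prop) (by fun_prop) (by simp))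
    have := hc.tendsto.mono_left (nhdsWithin_le_nhds (s := {0}ᶜ))
    simp only [zero_mul, zero_div, sub_zero, zero_sub] at this
    rw [neg_div]
    refine this.congr' ?_
    filter_upwards [self_mem_nhdsWithin] with s hs
    have hs : s ≠ 0 := hs
    rw [completedRiemannZeta_eq]
    field_simp
  have h3 := (h1.const_mul (1 / 2)).div h2 (by norm_num)
  rw [show (1 / 2 * -1 : ℂ) / (-1 / 2) = 1 by norm_num] at h3
  refine h3.congr' ?_
  have hhalf : ∀ᶠ s : ℂ in 𝓝[≠] 0, s ≠ 1 / 2 ∧ s ≠ 1 :=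
    nhdsWithin_le_nhds ((eventually_ne_nhds (by norm_num)).and (eventually_ne_nhds (by norm_num)))
  filter_upwards [self_mem_nhdsWithin, hhalf] with s hs hs'
  have hs : s ≠ 0 := hs
  rw [(completedEis_eventuallyEq Even.zero z (Or.inr ⟨hs, hs'.2⟩)).eq_of_nhds,
    thetaK_eq_thetaZeta 0 hs hs'.1, eisLambda, thetaZeta]
  simp only [Int.natAbs_zero, Nat.zero_div, pow_zero, mul_one, Finset.range_zero,
    Finset.prod_empty, Nat.cast_zero, add_zero, Pi.div_apply]
  field_simp

lemma harmonicEis_zero (z : ℍ) : harmonicEis 0 z = 1 := by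
  rw [harmonicEis, if_pos rfl]
  exact (tendsto_completedEis_div_thetaK_zero z).limUnder_eq

/-! ### The value `θ_k(k/2)` -/

lemma half_weight {k : ℤ} (hk : Even k) (h0 : k ≠ 0) :
    ((k : ℂ) / 2 ≠ 0) ∧ ((k : ℂ) / 2 ≠ 1 / 2) := by
  obtain ⟨m, rfl⟩ := hk
  refine ⟨by simpa using h0, fun h => ?_⟩
  have h' : ((m + m : ℤ) : ℂ) = ((1 : ℤ) : ℂ) := by
    push_cast at h ⊢
    linear_combination 2 * h
  have := Int.cast_injective h'
  omega

lemma thetaK_half_of_pos {k : ℕ} (hk : Even k) (h0 : 0 < k) :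
    thetaK k ((k : ℂ) / 2) = (π : ℂ) ^ (-((k : ℂ) / 2)) * (k - 1).factorial * riemannZeta k := by
  obtain ⟨m, rfl⟩ := hk
  have hm : (1 : ℝ) ≤ m := by exact_mod_cast (by omega : 1 ≤ m)
  have hc : (((m + m : ℕ) : ℂ)) / 2 = m := by push_cast; ring
  have : ((m + m : ℕ) : ℤ).natAbs / 2 = m := by omega
  rw [thetaK_of_one_half_lt_re _ (by rw [hc, natCast_re]; linarith), this, hc,
    show (m : ℂ) + m = ((m + m - 1 : ℕ) : ℂ) + 1 by
      rw [Nat.cast_sub (by omega)]; push_cast; ring, Gamma_nat_eq_factorial]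
  congr 2
  push_cast
  ring

/-- At `s = -K` the factors `Γ(s)` and `ζ(2s)` have a pole and a zero, so the value is taken from
the completed zeta function at `1 + 2K` by its functional equation. The duplication formula then
merges `Γ(K + 1/2) K!` into `(2K)!`. -/
lemma thetaK_half_of_neg {K : ℕ} (h0 : 0 < K) :
    thetaK (-(2 * K : ℕ)) (-K) = (-1) ^ K * (4 * π : ℂ) ^ (-(K : ℤ)) * (2 * K).factorial *
      riemannZeta (2 * K + 1) := by
  have hK0 : (K : ℂ) ≠ 0 := by exact_mod_cast h0.ne'
  have hpi : (π : ℂ) ≠ 0 := by exact_mod_cast Real.pi_ne_zero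
  have hs1 : (-K : ℂ) ≠ 1 / 2 := by
    intro h
    have := congrArg re h
    simp at this
    have h2 : (0 : ℝ) ≤ K := K.cast_nonneg
    norm_num at this
    linarith
  have hnat : (-(2 * K : ℕ) : ℤ).natAbs / 2 = K := by omega
  have hprod : ∏ i ∈ Finset.range K, (-(K : ℂ) + i) = (-1) ^ K * K.factorial := by
    rw [← Finset.prod_range_reflect]
    rw [← Finset.prod_range_add_one_eq_factorial]
    push_cast
    rw [← Finset.card_range K, ← Finset.prod_const, Finset.card_range, ← Finset.prod_mul_distrib]
    refine Finset.prod_congr rfl fun i hi => ?_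
    have hi := Finset.mem_range.mp hi
    rw [Nat.sub_sub, Nat.cast_sub (by omega)]
    push_cast
    ring
  have hne : (2 * K + 1 : ℂ) ≠ 0 := by exact_mod_cast (by omega : 2 * K + 1 ≠ 0)
  rw [thetaK_eq_thetaZeta _ (by simpa using h0.ne') hs1, thetaZeta, hnat, hprod,
    ← completedRiemannZeta_one_sub, show (1 - 2 * -(K : ℂ)) = 2 * K + 1 by ring,
    riemannZeta_def_of_ne_zero hne]
  have hG : Gammaℝ (2 * K + 1) ≠ 0 := by
    apply Gammaℝ_ne_zero_of_re_pos
    have : (0 : ℝ) ≤ K := K.cast_nonneg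
    simp
    linarith
  have hGv : Gammaℝ (2 * K + 1) * K.factorial = (4 * π : ℂ) ^ (-(K : ℤ)) * (2 * K).factorial := by
    have h1 := Gammaℝ_mul_Gammaℝ_add_one (2 * K + 1)
    have h2 : Gammaℝ (2 * K + 1 + 1) = (π : ℂ) ^ (-((K : ℂ) + 1)) * K.factorial := by
      rw [Gammaℝ_def, ← Gamma_nat_eq_factorial]
      congr 2 <;> ring
    have h3 : Gammaℂ (2 * K + 1) = 2 * (2 * π : ℂ) ^ (-(2 * (K : ℂ) + 1)) * (2 * K).factorial := by
      rw [Gammaℂ_def, ← Gamma_nat_eq_factorial]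
      push_cast
      ring
    have e1 : (π : ℂ) ^ (-((K : ℂ) + 1)) = (π : ℂ) ^ (-((K : ℤ) + 1)) := by
      rw [← cpow_intCast]; push_cast; ring_nf
    have e2 : (2 * π : ℂ) ^ (-(2 * (K : ℂ) + 1)) = (2 * π : ℂ) ^ (-(2 * (K : ℤ) + 1)) := by
      rw [← cpow_intCast]; push_cast; ring_nf
    rw [h2, h3, e1, e2] at h1
    have e3 : (π : ℂ) ^ (-((K : ℤ) + 1)) ≠ 0 := zpow_ne_zero _ hpi
    have e4 : 2 * (2 * π : ℂ) ^ (-(2 * (K : ℤ) + 1)) =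
        (4 * π : ℂ) ^ (-(K : ℤ)) * (π : ℂ) ^ (-((K : ℤ) + 1)) := by
      rw [zpow_neg, zpow_neg, zpow_neg, zpow_add_one₀ (by simp [hpi]), zpow_add_one₀ hpi,
        zpow_mul]
      simp only [zpow_natCast, zpow_ofNat, mul_pow, ← pow_mul]
      rw [show (4 : ℂ) = 2 ^ 2 by norm_num, ← pow_mul]
      field_simp
      ring
    rw [e4] at h1
    apply mul_right_cancel₀ e3
    linear_combination h1
  have : completedRiemannZeta (2 * K + 1) * ((-1) ^ K * K.factorial) =
      (-1) ^ K * (Gammaℝ (2 * K + 1) * K.factorial) * (completedRiemannZeta (2 * K + 1) /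
        Gammaℝ (2 * K + 1)) := by
    field_simp
  rw [this, hGv]
  ring

lemma thetaK_half_ne_zero {k : ℤ} (hk : Even k) (h0 : k ≠ 0) : thetaK k ((k : ℂ) / 2) ≠ 0 := by
  have hpi : (π : ℂ) ≠ 0 := by exact_mod_cast Real.pi_ne_zero
  rcases lt_or_gt_of_ne h0 with h | h
  · obtain ⟨K, hK⟩ : ∃ K : ℕ, k = -(2 * K : ℕ) := by
      obtain ⟨m, hm⟩ := hk
      exact ⟨m.natAbs, by omega⟩
    have hK0 : 0 < K := by omega
    have : (k : ℂ) / 2 = -K := by rw [hK]; push_cast; ring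
    rw [this, hK, thetaK_half_of_neg hK0]
    have hz : riemannZeta (2 * K + 1) ≠ 0 := by
      apply riemannZeta_ne_zero_of_one_lt_re
      have : (1 : ℝ) ≤ K := by exact_mod_cast hK0
      simp
      linarith
    have : ((2 * K).factorial : ℂ) ≠ 0 := by exact_mod_cast (2 * K).factorial_ne_zero
    simp [hz, this]
  · obtain ⟨n, rfl⟩ := Int.eq_ofNat_of_zero_le h.le
    have hn : 0 < n := by exact_mod_cast h
    have hkn : Even n := by exact_mod_cast hk
    rw [Int.cast_natCast, thetaK_half_of_pos hkn hn]
    have hz : riemannZeta n ≠ 0 := by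
      apply riemannZeta_ne_zero_of_one_lt_re
      obtain ⟨m, rfl⟩ := hkn
      rw [natCast_re]
      exact_mod_cast (by omega : 1 < m + m)
    have : ((n - 1).factorial : ℂ) ≠ 0 := by exact_mod_cast (n - 1).factorial_ne_zero
    simp [hz, this, cpow_eq_zero_iff, hpi]

/-! ### Convergence of the Fourier series -/

lemma norm_sigma_le (w : ℤ) (m : ℕ+) : ‖sigma w m‖ ≤ (m : ℝ) ^ (w.natAbs + 1) := by
  have h1 : ∀ d ∈ (m : ℕ).divisors, ‖(d : ℂ) ^ w‖ ≤ (m : ℝ) ^ w.natAbs := by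
    intro d hd
    have hd0 : (1 : ℝ) ≤ d := by exact_mod_cast Nat.pos_of_mem_divisors hd
    have hdm : (d : ℝ) ≤ m := by exact_mod_cast Nat.divisor_le hd
    rw [norm_zpow, norm_natCast]
    calc (d : ℝ) ^ w ≤ (d : ℝ) ^ (w.natAbs : ℤ) := zpow_le_zpow_right₀ hd0 (by omega)
      _ = (d : ℝ) ^ w.natAbs := zpow_natCast _ _
      _ ≤ _ := by gcongr
  calc ‖sigma w m‖ ≤ ∑ d ∈ (m : ℕ).divisors, (m : ℝ) ^ w.natAbs :=
        norm_sum_le_of_le _ h1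
    _ = (m : ℕ).divisors.card * (m : ℝ) ^ w.natAbs := by rw [Finset.sum_const, nsmul_eq_mul]
    _ ≤ m * (m : ℝ) ^ w.natAbs := by
        gcongr
        exact Nat.card_divisors_le_self _
    _ = _ := by ring

lemma summable_pow_mul_exp_pnat (N : ℕ) {y : ℝ} (hy : 0 < y) :
    Summable fun m : ℕ+ => (m : ℝ) ^ N * Real.exp (-(2 * π * y * m)) := by
  have := (Real.summable_pow_mul_exp_neg_nat_mul N (r := 2 * π * y) (by positivity)).comp_injective
    PNat.coe_injective
  refine this.congr fun m => ?_
  simp only [Function.comp_apply]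
  congr 2
  ring

lemma norm_exp_two_pi_mul (z : ℍ) (m : ℕ+) :
    ‖cexp (2 * π * I * (m : ℂ) * z)‖ = Real.exp (-(2 * π * z.im * m)) := by
  rw [norm_exp]
  congr 1
  rw [show 2 * (π : ℂ) * I * (m : ℂ) * z = ((2 * π * m : ℝ) : ℂ) * (I * z) by push_cast; ring,
    re_ofReal_mul]
  simp
  ring

lemma norm_exp_two_pi_mul_conj (z : ℍ) (m : ℕ+) :
    ‖cexp (-(2 * π * I * (m : ℂ) * conj (z : ℂ)))‖ = Real.exp (-(2 * π * z.im * m)) := by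
  rw [← norm_exp_two_pi_mul, ← RCLike.norm_conj (cexp _), ← exp_conj]
  congr 2
  simp only [map_neg, map_mul, conj_conj, conj_I, conj_ofReal, map_natCast, map_ofNat]
  ring

lemma summable_holTerm (k : ℤ) (z : ℍ) : Summable (holTerm k z) := by
  refine Summable.of_norm_bounded
    (summable_pow_mul_exp_pnat ((k - 1).natAbs + 1) z.im_pos) fun m => ?_
  rw [holTerm, norm_mul, norm_exp_two_pi_mul]
  gcongr
  exact norm_sigma_le _ m

lemma summable_nonholTerm (k : ℤ) (z : ℍ) : Summable (nonholTerm k z) := by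
  unfold nonholTerm
  simp only [Finset.mul_sum]
  refine summable_sum fun u _ => ?_
  refine Summable.of_norm_bounded
    ((summable_pow_mul_exp_pnat ((k - 1).natAbs + 1 + u) z.im_pos).mul_left
      ((4 * π * z.im) ^ u / u.factorial)) fun m => ?_
  have hy := z.im_pos
  have h1 : ‖(4 * (π : ℂ) * (m : ℂ) * (z.im : ℂ)) ^ u / (u.factorial : ℂ)‖ =
      (4 * π * z.im) ^ u / u.factorial * (m : ℝ) ^ u := by
    rw [norm_div, norm_pow, norm_natCast,
      show 4 * (π : ℂ) * (m : ℂ) * (z.im : ℂ) = ((4 * π * z.im * m : ℝ) : ℂ) by push_cast; ring,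
      norm_real, Real.norm_of_nonneg (by positivity), mul_pow]
    ring
  rw [norm_mul, norm_mul, norm_exp_two_pi_mul_conj, h1, pow_add]
  have h2 := norm_sigma_le (k - 1) m
  calc _ ≤ (m : ℝ) ^ ((k - 1).natAbs + 1) * Real.exp (-(2 * π * z.im * m)) *
        ((4 * π * z.im) ^ u / u.factorial * (m : ℝ) ^ u) := by gcongr
    _ = _ := by ring

/-! ### Row sums by Lipschitz's formula and partial fractions -/

/-- The series `∑_{r ≥ 1} r ^ u e^{2π i r τ}`. -/
noncomputable def qSeries (u : ℕ) (τ : ℍ) : ℂ :=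
  ∑' r : ℕ+, (r : ℂ) ^ u * cexp (2 * π * I * (r : ℂ) * τ)

lemma cexp_pow_pnat (τ : ℍ) (r : ℕ) : cexp (2 * π * I * τ) ^ r = cexp (2 * π * I * r * τ) := by
  rw [← Complex.exp_nat_mul]
  congr 1
  ring

lemma tsum_inv_pow_eq_qSeries (p : ℕ) (τ : ℍ) :
    ∑' n : ℤ, 1 / ((τ : ℂ) + n) ^ (p + 2) =
      (-2 * π * I) ^ (p + 2) / (p + 1).factorial * qSeries (p + 1) τ := by
  rw [qExpansion_identity_pnat (k := p + 1) (by omega), qSeries]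
  simp only [cexp_pow_pnat]

lemma conj_add_int (τ : ℍ) (n : ℤ) : conj ((τ : ℂ) + n) = conj (τ : ℂ) + n := by simp

lemma add_int_ne_zero (τ : ℍ) (n : ℤ) : (τ : ℂ) + n ≠ 0 := by
  intro h
  have := congrArg im h
  simp at this
  exact τ.im_pos.ne' this

lemma conj_add_int_ne_zero (τ : ℍ) (n : ℤ) : conj (τ : ℂ) + n ≠ 0 := by
  rw [← conj_add_int, Ne, map_eq_zero]
  exact add_int_ne_zero τ n

lemma tsum_conj_inv_pow_eq_qSeries (p : ℕ) (τ : ℍ) :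
    ∑' n : ℤ, 1 / (conj (τ : ℂ) + n) ^ (p + 2) =
      (2 * π * I) ^ (p + 2) / (p + 1).factorial * conj (qSeries (p + 1) τ) := by
  have h := congrArg conj (tsum_inv_pow_eq_qSeries p τ)
  rw [Complex.conj_tsum] at h
  have h2 : conj (2 : ℂ) = 2 := map_ofNat _ 2
  simpa [h2] using h

lemma pi_mul_cot_eq_qSeries (τ : ℍ) :
    π * cot (π * τ) = -(π * I) - 2 * π * I * qSeries 0 τ := by
  rw [pi_mul_cot_pi_q_exp, qSeries]
  have hs : Summable fun n : ℕ => cexp (2 * π * I * τ) ^ n :=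
    summable_geometric_iff_norm_lt_one.mpr (UpperHalfPlane.norm_exp_two_pi_I_lt_one τ)
  rw [← tsum_zero_pnat_eq_tsum_nat hs]
  simp only [pow_zero, one_mul, cexp_pow_pnat]
  ring

lemma summable_inv_mul_conj (p : ℕ) (τ : ℍ) :
    Summable fun n : ℤ => 1 / (((τ : ℂ) + n) * (conj (τ : ℂ) + n) ^ (p + 1)) := by
  have h := (linear_right_summable (τ : ℂ) 1 (k := (p + 2 : ℕ)) (by omega)).norm
  refine Summable.of_norm (h.congr fun n => ?_)
  rw [← conj_add_int]
  simp only [Int.cast_one, one_mul, norm_inv, norm_mul, norm_pow, RCLike.norm_conj, one_div,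
    zpow_natCast]
  ring

lemma sub_conj_eq (τ : ℍ) : (τ : ℂ) - conj (τ : ℂ) = 2 * I * τ.im := by
  rw [sub_conj]
  push_cast
  simp
  ring

lemma two_I_im_ne_zero (τ : ℍ) : 2 * I * (τ.im : ℂ) ≠ 0 := by
  have : (τ.im : ℂ) ≠ 0 := by exact_mod_cast τ.im_pos.ne'
  simp [this]

lemma summable_int_pnat {f : ℤ → ℂ} (hf : Summable f) :
    (Summable fun n : ℕ+ => f n) ∧ Summable fun n : ℕ+ => f (-n) := by
  refine ⟨hf.comp_injective (i := fun n : ℕ+ => ((n : ℕ) : ℤ)) fun a b h => ?_,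
    hf.comp_injective (i := fun n : ℕ+ => -((n : ℕ) : ℤ)) fun a b h => ?_⟩
  · exact PNat.coe_injective (by simpa using h)
  · exact PNat.coe_injective (by simpa using h)

/-- Partial fractions split the term into `1/(τ̄ + n) - 1/(τ + n)` over `τ - τ̄`. Neither half is
absolutely summable, so `n` is paired with `-n`, which makes each half a cotangent series. -/
lemma tsum_inv_mul_conj_zero (τ : ℍ) :
    ∑' n : ℤ, 1 / (((τ : ℂ) + n) * (conj (τ : ℂ) + n)) =
      2 * π * I * (2 * I * τ.im)⁻¹ * (1 + qSeries 0 τ + conj (qSeries 0 τ)) := by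
  have hc := two_I_im_ne_zero τ
  have hs : Summable fun n : ℤ => 1 / (((τ : ℂ) + n) * (conj (τ : ℂ) + n)) := by
    simpa using summable_inv_mul_conj 0 τ
  have hterm : ∀ n : ℤ, (2 * I * τ.im) * (1 / (((τ : ℂ) + n) * (conj (τ : ℂ) + n))) =
      1 / (conj (τ : ℂ) + n) - 1 / ((τ : ℂ) + n) := by
    intro n
    have h1 := add_int_ne_zero τ n
    have h2 := conj_add_int_ne_zero τ n
    rw [← sub_conj_eq]
    field_simp
    ring
  have hs' := hs.mul_left (2 * I * τ.im)
  have hmem : (τ : ℂ) ∈ integerComplement := UpperHalfPlane.coe_mem_integerComplement τ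
  have hcs : Summable fun n : ℕ+ => (1 / ((τ : ℂ) - n) + 1 / ((τ : ℂ) + n)) := by
    have := summable_cotTerm hmem
    rw [summable_pnat_iff_summable_succ (f := fun n : ℕ => 1 / ((τ : ℂ) - n) + 1 / ((τ : ℂ) + n))]
    simpa [cotTerm] using this
  have hcot := cot_series_rep hmem
  have hcot' := congrArg conj hcot
  rw [map_add, Complex.conj_tsum] at hcot'
  have hcs' : Summable fun n : ℕ+ => conj (1 / ((τ : ℂ) - n) + 1 / ((τ : ℂ) + n)) := by
    exact (Complex.hasSum_conj'.mpr hcs.hasSum).summable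
  have key : (2 * I * τ.im) * ∑' n : ℤ, 1 / (((τ : ℂ) + n) * (conj (τ : ℂ) + n)) =
      conj (π * cot (π * τ)) - π * cot (π * τ) := by
    rw [← tsum_mul_left, tsum_int_eq_zero_add_tsum_pnat hs', hcot', hcot]
    simp only [hterm] at hs' ⊢
    obtain ⟨hp, hm⟩ := summable_int_pnat hs'
    rw [add_sub_add_comm, ← hcs'.tsum_sub hcs, add_assoc, ← hp.tsum_add hm]
    congr 1
    · simp
    · refine tsum_congr fun n => ?_
      simp [← sub_eq_add_neg]
      ring
  have h2 : conj (2 : ℂ) = 2 := map_ofNat _ 2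
  rw [pi_mul_cot_eq_qSeries] at key
  rw [← mul_right_inj' hc, key]
  simp only [map_sub, map_neg, map_mul, conj_I, conj_ofReal, h2]
  generalize conj (qSeries 0 τ) = B
  generalize qSeries 0 τ = A
  generalize 2 * I * (τ.im : ℂ) = c at hc ⊢
  field_simp
  ring

/-- The finite sums of `q`-series occurring in `∑ₙ (τ + n)⁻¹ (τ̄ + n)^(-p-1)`. -/
lemma tsum_inv_mul_conj_pow (p : ℕ) (τ : ℍ) :
    ∑' n : ℤ, 1 / (((τ : ℂ) + n) * (conj (τ : ℂ) + n) ^ (p + 1)) =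
      2 * π * I * (-1) ^ p * ((2 * I * τ.im) ^ (p + 1))⁻¹ * (1 + qSeries 0 τ +
        ∑ u ∈ Finset.range (p + 1), (4 * π * τ.im : ℂ) ^ u / u.factorial *
          conj (qSeries u τ)) := by
  have hc := two_I_im_ne_zero τ
  induction p with
  | zero => simpa using tsum_inv_mul_conj_zero τ
  | succ p ih =>
    -- One more partial fraction step: the pure power of `τ̄ + n` yields, by Lipschitz's formula,
    -- exactly the new term `u = p + 1`.
    have hterm : ∀ n : ℤ, 1 / (((τ : ℂ) + n) * (conj (τ : ℂ) + n) ^ (p + 1 + 1)) =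
        (2 * I * τ.im)⁻¹ * (1 / (conj (τ : ℂ) + n) ^ (p + 2) -
          1 / (((τ : ℂ) + n) * (conj (τ : ℂ) + n) ^ (p + 1))) := by
      intro n
      have h1 := add_int_ne_zero τ n
      have h2 := conj_add_int_ne_zero τ n
      rw [← sub_conj_eq]
      have h3 : (τ : ℂ) - conj (τ : ℂ) ≠ 0 := by rw [sub_conj_eq]; exact hc
      field_simp
      ring
    have hs2 : Summable fun n : ℤ => 1 / (conj (τ : ℂ) + n) ^ (p + 2) := by
      have h := linear_right_summable (conj (τ : ℂ)) 1 (k := (p + 2 : ℕ)) (by omega)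
      refine h.congr fun n => ?_
      simp [← zpow_natCast]
    simp only [hterm]
    rw [tsum_mul_left, hs2.tsum_sub (summable_inv_mul_conj p τ), ih,
      tsum_conj_inv_pow_eq_qSeries, Finset.sum_range_succ _ (p + 1)]
    have e : (4 * π * τ.im : ℂ) ^ (p + 1) =
        (-1) ^ (p + 1) * (2 * π * I) ^ (p + 1) * (2 * I * τ.im) ^ (p + 1) := by
      rw [← mul_pow, ← mul_pow]
      congr 1
      linear_combination (4 * π * τ.im : ℂ) * I_mul_I
    have e2 : ((-1 : ℂ) ^ p) * (-1) ^ p = 1 := by rw [← mul_pow]; simp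
    rw [e, pow_succ (2 * π * I : ℂ) (p + 1), pow_succ (2 * I * τ.im : ℂ) (p + 1),
      pow_succ (-1 : ℂ) p]
    have hD := pow_ne_zero (p + 1) hc
    have hf : ((p + 1).factorial : ℂ) ≠ 0 := by exact_mod_cast (p + 1).factorial_ne_zero
    generalize (2 * I * τ.im : ℂ) ^ (p + 1) = D at *
    generalize (2 * I * τ.im : ℂ) = c at *
    generalize (2 * π * I : ℂ) ^ (p + 1) = E
    generalize ∑ u ∈ Finset.range (p + 1), (4 * π * τ.im : ℂ) ^ u / u.factorial *
      conj (qSeries u τ) = X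
    generalize conj (qSeries (p + 1) τ) = B
    generalize qSeries 0 τ = A
    generalize (-1 : ℂ) ^ p = ε at *
    field_simp
    linear_combination (-(D * E * B)) * e2

/-! ### Unfolding divisor sums into double series -/

lemma norm_sigma (w : ℤ) (N : ℕ+) : ‖sigma w N‖ = ∑ d ∈ (N : ℕ).divisors, ‖(d : ℂ) ^ w‖ := by
  have h : sigma w N = ((∑ d ∈ (N : ℕ).divisors, (d : ℝ) ^ w : ℝ) : ℂ) := by
    rw [sigma]
    push_cast
    rfl
  rw [h, norm_real, Real.norm_of_nonneg (Finset.sum_nonneg fun d _ => by positivity)]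
  simp only [norm_zpow, norm_natCast]

lemma sum_divisorsAntidiagonal_subtype {E : Type*} [AddCommMonoid E] (f : ℕ → E) (N : ℕ+) :
    ∑ x : Nat.divisorsAntidiagonal N, f x.1.1 = ∑ d ∈ (N : ℕ).divisors, f d := by
  rw [Finset.sum_coe_sort (Nat.divisorsAntidiagonal N) (fun x => f x.1),
    Nat.sum_divisorsAntidiagonal (fun x _ => f x)]

/-- Write `N = d r`. Powers of divisors are positive, so `σ_w` has no cancellation and absolute
convergence passes from the single series to the double one. -/
lemma summable_and_tsum_sigma_mul {w : ℤ} {φ : ℕ+ → ℂ}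
    (h : Summable fun N : ℕ+ => sigma w N * φ N) :
    (Summable fun p : ℕ+ × ℕ+ => ((p.1 : ℕ) : ℂ) ^ w * φ (p.1 * p.2)) ∧
      ∑' N : ℕ+, sigma w N * φ N = ∑' d : ℕ+, ∑' r : ℕ+, ((d : ℕ) : ℂ) ^ w * φ (d * r) := by
  set F : (Σ n : ℕ+, Nat.divisorsAntidiagonal n) → ℂ :=
    fun x => (x.2.1.1 : ℂ) ^ w * φ x.1 with hF
  have hinner : ∀ N : ℕ+, ∑' x : Nat.divisorsAntidiagonal N, F ⟨N, x⟩ = sigma w N * φ N := by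
    intro N
    rw [tsum_fintype]
    simp only [hF]
    rw [← Finset.sum_mul, sigma, sum_divisorsAntidiagonal_subtype (fun d => (d : ℂ) ^ w)]
  have hinner' : ∀ N : ℕ+, ∑' x : Nat.divisorsAntidiagonal N, ‖F ⟨N, x⟩‖ =
      ‖sigma w N * φ N‖ := by
    intro N
    rw [tsum_fintype, norm_mul, norm_sigma]
    simp only [hF, norm_mul]
    rw [← Finset.sum_mul, sum_divisorsAntidiagonal_subtype (fun d => ‖(d : ℂ) ^ w‖)]
  have hsF : Summable F := by
    rw [← summable_norm_iff, summable_sigma_of_nonneg (fun _ => norm_nonneg _)]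
    refine ⟨fun N => Summable.of_finite, ?_⟩
    simp only [hinner']
    exact h.norm
  have hcomp : ∀ p : ℕ+ × ℕ+, F (sigmaAntidiagonalEquivProd.symm p) =
      ((p.1 : ℕ) : ℂ) ^ w * φ (p.1 * p.2) := by
    intro p
    rfl
  have hsP : Summable fun p : ℕ+ × ℕ+ => ((p.1 : ℕ) : ℂ) ^ w * φ (p.1 * p.2) :=
    (sigmaAntidiagonalEquivProd.symm.summable_iff.mpr hsF).congr hcomp
  refine ⟨hsP, ?_⟩
  rw [← hsP.tsum_prod]
  simp only [← hcomp, ← hinner]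
  rw [sigmaAntidiagonalEquivProd.symm.tsum_eq, hsF.tsum_sigma]

/-- The multiple `m z` of a point of the upper half plane. -/
def posMul (m : ℕ+) (z : ℍ) : ℍ := ⟨(m : ℂ) * (z : ℂ), by
  simp only [mul_im, natCast_re, natCast_im, zero_mul, add_zero]
  exact mul_pos (by exact_mod_cast m.pos) z.im_pos⟩

lemma coe_posMul (m : ℕ+) (z : ℍ) : (posMul m z : ℂ) = (m : ℂ) * (z : ℂ) := rfl

lemma im_posMul (m : ℕ+) (z : ℍ) : (posMul m z).im = m * z.im := by
  change ((m : ℂ) * (z : ℂ)).im = _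
  simp

lemma tsum_lattice_eq {f : ℤ × ℤ → ℂ} (hf : Summable f) (heven : ∀ p, f (-p) = f p) :
    ∑' p, f p = (∑' n, f (0, n)) + 2 * ∑' m : ℕ+, ∑' n : ℤ, f (m, n) := by
  rw [hf.tsum_prod, tsum_int_eq_zero_add_two_mul_tsum_pnat (fun m => ?_) hf.prod, two_mul,
    two_nsmul]
  rw [← tsum_comp_neg]
  refine tsum_congr fun n => ?_
  rw [← heven]
  simp

lemma tsum_exp_mul_sum (L : ℕ) (z : ℍ) (m : ℕ+) :
    ∑ u ∈ Finset.range L, (4 * π * (posMul m z).im : ℂ) ^ u / u.factorial *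
      conj (qSeries u (posMul m z)) =
    ∑' r : ℕ+, cexp (-(2 * π * I * ((m * r : ℕ+) : ℂ) * conj (z : ℂ))) *
      ∑ u ∈ Finset.range L, (4 * π * ((m * r : ℕ+) : ℂ) * z.im : ℂ) ^ u / u.factorial := by
  have h2 : conj (2 : ℂ) = 2 := map_ofNat _ 2
  have hs : ∀ u : ℕ, Summable fun r : ℕ+ => (r : ℂ) ^ u * cexp (2 * π * I * (r : ℂ) *
      (posMul m z : ℂ)) := by
    intro u
    refine Summable.of_norm_bounded (summable_pow_mul_exp_pnat u (posMul m z).im_pos) fun r => ?_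
    rw [norm_mul, norm_exp_two_pi_mul, norm_pow, norm_natCast]
  simp only [Finset.mul_sum]
  rw [Summable.tsum_finsetSum]
  · refine Finset.sum_congr rfl fun u _ => ?_
    rw [qSeries, Complex.conj_tsum, ← tsum_mul_left]
    refine tsum_congr fun r => ?_
    rw [map_mul, map_pow, ← exp_conj, coe_posMul, im_posMul]
    simp only [map_mul, conj_I, conj_ofReal, h2, map_natCast]
    push_cast
    rw [show (4 * (π : ℂ) * (m * r) * z.im) = (4 * π * (m * z.im)) * r by ring, mul_pow _ (r : ℂ)]
    rw [show 2 * (π : ℂ) * -I * r * (m * conj (z : ℂ)) =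
      -(2 * π * I * (m * r) * conj (z : ℂ)) by ring]
    ring
  · intro u _
    have := (Complex.hasSum_conj'.mpr (hs u).hasSum).summable
    refine (this.mul_left ((4 * π * (m * z.im) : ℂ) ^ u / u.factorial)).congr fun r => ?_
    rw [map_mul, map_pow, ← exp_conj, coe_posMul]
    simp only [map_mul, conj_I, conj_ofReal, h2, map_natCast]
    push_cast
    rw [show (4 * (π : ℂ) * (m * r) * z.im) = (4 * π * (m * z.im)) * r by ring, mul_pow _ (r : ℂ)]
    rw [show 2 * (π : ℂ) * -I * r * (m * conj (z : ℂ)) =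
      -(2 * π * I * (m * r) * conj (z : ℂ)) by ring]
    ring

lemma qSeries_zero_posMul (m : ℕ+) (z : ℍ) : qSeries 0 (posMul m z) =
    ∑' r : ℕ+, cexp (2 * π * I * ((m * r : ℕ+) : ℂ) * z) := by
  rw [qSeries]
  refine tsum_congr fun r => ?_
  rw [coe_posMul, pow_zero, one_mul]
  congr 1
  push_cast
  ring

lemma zeta_eq_tsum_pnat_zpow {P : ℕ} (hP : 1 < P) :
    riemannZeta P = ∑' m : ℕ+, ((m : ℕ) : ℂ) ^ (-(P : ℤ)) := by
  rw [zeta_nat_eq_tsum_of_gt_one hP, ← tsum_zero_pnat_eq_tsum_nat]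
  · simp [show P ≠ 0 by omega]
  · simpa using (Complex.summable_one_div_nat_cpow (p := P)).mpr (by simpa using hP)

/-! ### Negative weight -/

/-- The sum over the rows `m ≥ 1` in negative weight. -/
lemma tsum_rows_neg {K : ℕ} (hK : 0 < K) (z : ℍ) :
    ∑' m : ℕ+, ∑' n : ℤ, 1 / (((m : ℂ) * z + n) * conj ((m : ℂ) * z + n) ^ (2 * K + 1)) =
      π * ((-4 : ℂ) ^ K * (z.im : ℂ) ^ (2 * K + 1))⁻¹ * (riemannZeta (2 * K + 1) +
        ∑' m : ℕ+, holTerm (-(2 * K : ℕ)) z m + ∑' m : ℕ+, nonholTerm (-(2 * K : ℕ)) z m) := by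
  have hy : (z.im : ℂ) ≠ 0 := by exact_mod_cast z.im_pos.ne'
  have hh := summable_and_tsum_sigma_mul (w := -(2 * K : ℕ) - 1)
    (φ := fun N => cexp (2 * π * I * (N : ℂ) * z)) (summable_holTerm (-(2 * K : ℕ)) z)
  have hn := summable_and_tsum_sigma_mul (w := -(2 * K : ℕ) - 1)
    (φ := fun N => cexp (-(2 * π * I * (N : ℂ) * conj (z : ℂ))) *
      ∑ u ∈ Finset.range (1 - (-(2 * K : ℕ) : ℤ)).toNat,
        (4 * (π : ℂ) * (N : ℂ) * (z.im : ℂ)) ^ u / (u.factorial : ℂ))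
    ((summable_nonholTerm (-(2 * K : ℕ)) z).congr fun N => by rw [nonholTerm]; ring)
  have hw : (-(2 * K : ℕ) - 1 : ℤ) = -((2 * K + 1 : ℕ) : ℤ) := by push_cast; ring
  have hL : (1 - (-(2 * K : ℕ) : ℤ)).toNat = 2 * K + 1 := by omega
  have hz := zeta_eq_tsum_pnat_zpow (P := 2 * K + 1) (by omega)
  have hsz : Summable fun m : ℕ+ => ((m : ℕ) : ℂ) ^ (-((2 * K + 1 : ℕ) : ℤ)) := by
    have h1 : Summable fun n : ℕ => 1 / (n : ℂ) ^ ((2 * K + 1 : ℕ) : ℂ) :=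
      Complex.summable_one_div_nat_cpow.mpr (by
        rw [natCast_re]; exact_mod_cast (by omega : 1 < 2 * K + 1))
    refine (h1.comp_injective PNat.coe_injective).congr fun m => ?_
    simp only [Function.comp_apply, cpow_natCast, zpow_neg, zpow_natCast, one_div]
  have e1 : ∑' m : ℕ+, nonholTerm (-(2 * K : ℕ)) z m = ∑' N : ℕ+, sigma (-(2 * K : ℕ) - 1) N *
      (cexp (-(2 * π * I * (N : ℂ) * conj (z : ℂ))) *
      ∑ u ∈ Finset.range (1 - (-(2 * K : ℕ) : ℤ)).toNat,
        (4 * (π : ℂ) * (N : ℂ) * (z.im : ℂ)) ^ u / (u.factorial : ℂ)) :=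
    tsum_congr fun N => by rw [nonholTerm]; ring
  have e2 : ∑' m : ℕ+, holTerm (-(2 * K : ℕ)) z m = ∑' N : ℕ+, sigma (-(2 * K : ℕ) - 1) N *
      cexp (2 * π * I * (N : ℂ) * z) := rfl
  rw [e1, e2, hh.2, hn.2]
  replace hh := hh.1.prod
  replace hn := hn.1.prod
  rw [hw] at hh hn ⊢
  rw [hL] at hn ⊢
  have hzz : riemannZeta (2 * K + 1) = riemannZeta ((2 * K + 1 : ℕ) : ℂ) := by push_cast; rfl
  rw [hzz, hz, ← hsz.tsum_add hh, ← (hsz.add hh).tsum_add hn, ← tsum_mul_left]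
  refine tsum_congr fun m => ?_
  have h := tsum_inv_mul_conj_pow (2 * K) (posMul m z)
  rw [tsum_exp_mul_sum, qSeries_zero_posMul] at h
  simp only [coe_posMul, im_posMul] at h
  have hl : ∀ n : ℤ, conj ((m : ℂ) * z + n) = conj ((m : ℂ) * (z : ℂ)) + n := by intro n; simp
  simp only [hl]
  rw [h, tsum_mul_left, tsum_mul_left]
  have hm : ((m : ℕ) : ℂ) ≠ 0 := by exact_mod_cast m.ne_zero
  rw [zpow_neg, zpow_natCast]
  have hI : (2 * I * ((m * z.im : ℝ) : ℂ)) ^ (2 * K + 1) =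
      (-4) ^ K * (2 * I) * m ^ (2 * K + 1) * z.im ^ (2 * K + 1) := by
    push_cast
    rw [show 2 * I * ((m : ℂ) * z.im) = (2 * I) * m * z.im by ring, mul_pow, mul_pow,
      pow_succ (2 * I) (2 * K), pow_mul (2 * I), mul_pow 2 I, I_sq]
    norm_num
  rw [hI, pow_mul (-1 : ℂ)]
  generalize (∑' r : ℕ+, cexp (2 * π * I * ((m * r : ℕ+) : ℂ) * z)) = A
  generalize (∑' r : ℕ+, cexp (-(2 * π * I * ((m * r : ℕ+) : ℂ) * conj (z : ℂ))) *
      ∑ u ∈ Finset.range (2 * K + 1), (4 * π * ((m * r : ℕ+) : ℂ) * z.im : ℂ) ^ u /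
        u.factorial) = B
  field_simp
  simp

/-- The point `K + 1` is the reflection `1 - k/2` of `k/2 = -K`; there all exponents become
integers. -/
lemma latTerm_neg_weight (K : ℕ) (z : ℍ) (v : Fin 2 → ℤ) :
    latTerm (-(2 * K : ℕ)) z (K + 1) v =
      (z.im : ℂ) ^ (K + 1) * (1 / (lin z v * conj (lin z v) ^ (2 * K + 1))) := by
  by_cases hv : v = 0
  · have : (K + 1 : ℂ) ≠ 0 := by exact_mod_cast K.succ_ne_zero
    rw [hv, latTerm_zero _ _ this]
    simp
  · have hw := lin_ne_zero z hv
    have hn : (‖lin z v‖ : ℂ) ≠ 0 := by exact_mod_cast (norm_pos_iff.mpr hw).ne'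
    have hc : conj (lin z v) ≠ 0 := by simpa using hw
    have hwc : lin z v * conj (lin z v) = (‖lin z v‖ : ℂ) ^ 2 := by
      rw [mul_conj, normSq_eq_norm_sq]; push_cast; rfl
    rw [latTerm, neg_neg, zpow_natCast, show (K + 1 : ℂ) = ((K + 1 : ℕ) : ℂ) by push_cast; rfl,
      cpow_natCast, div_pow, pow_mul (‖lin z v‖ : ℂ)]
    push_cast
    rw [← hwc]
    generalize conj (lin z v) = b at *
    generalize lin z v = a at *
    rw [mul_pow, div_pow, mul_pow, two_mul, pow_add a K K, pow_succ a K, pow_succ b K, pow_succ b (K + K),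
      pow_add b K K]
    have ha' := pow_ne_zero K hw
    have hb' := pow_ne_zero K hc
    generalize a ^ K = A at *
    generalize b ^ K = B at *
    field_simp

lemma tsum_fin_two_eq {f : (Fin 2 → ℤ) → ℂ} (hf : Summable f) (heven : ∀ v, f (-v) = f v) :
    ∑' v, f v = (∑' n : ℤ, f ![0, n]) + 2 * ∑' m : ℕ+, ∑' n : ℤ, f ![m, n] := by
  have h := tsum_lattice_eq (f := fun p : ℤ × ℤ => f ![p.1, p.2])
    (((finTwoArrowEquiv ℤ).symm.summable_iff.mpr hf).congr fun p => by
      rw [Function.comp_apply, finTwoArrowEquiv_symm_apply]) fun p => by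
      rw [← heven]
      congr 1
      simp
  rw [← h, ← (finTwoArrowEquiv ℤ).symm.tsum_eq]
  simp only [finTwoArrowEquiv_symm_apply]

lemma lin_neg (z : ℍ) (v : Fin 2 → ℤ) : lin z (-v) = -lin z v := by
  simp only [lin, Pi.neg_apply]
  push_cast
  ring

lemma tsum_row_zero_neg {K : ℕ} (hK : 0 < K) (z : ℍ) :
    ∑' n : ℤ, 1 / (lin z ![0, n] * conj (lin z ![0, n]) ^ (2 * K + 1)) =
      2 * riemannZeta (2 * K + 2) := by
  have h := two_mul_riemannZeta_eq_tsum_int_inv_pow_of_even (k := 2 * K + 2) (by omega)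
    ⟨K + 1, by ring⟩
  push_cast at h
  rw [h]
  refine tsum_congr fun n => ?_
  have : lin z ![0, n] = n := by simp [lin]
  rw [this, map_intCast, ← pow_succ', one_div]

lemma tsum_latTerm_neg_weight {K : ℕ} (hK : 0 < K) (z : ℍ) :
    ∑' v, latTerm (-(2 * K : ℕ)) z (K + 1) v = (z.im : ℂ) ^ (K + 1) *
      (2 * riemannZeta (2 * K + 2) + 2 * (π * ((-4 : ℂ) ^ K * (z.im : ℂ) ^ (2 * K + 1))⁻¹ *
        (riemannZeta (2 * K + 1) + ∑' m : ℕ+, holTerm (-(2 * K : ℕ)) z m +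
          ∑' m : ℕ+, nonholTerm (-(2 * K : ℕ)) z m))) := by
  have hy : (z.im : ℂ) ≠ 0 := by exact_mod_cast z.im_pos.ne'
  have hre : 1 < (K + 1 : ℂ).re := by
    have : (1 : ℝ) ≤ K := by exact_mod_cast hK
    simp only [add_re, natCast_re, one_re]
    linarith
  have hsum := (summable_norm_latTerm (-(2 * K : ℕ)) z hre).of_norm
  have hsum' : Summable fun v => 1 / (lin z v * conj (lin z v) ^ (2 * K + 1)) :=
    (summable_mul_left_iff (pow_ne_zero (K + 1) hy)).mp
      (hsum.congr fun v => latTerm_neg_weight K z v)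
  rw [tsum_congr fun v => latTerm_neg_weight K z v, tsum_mul_left, tsum_fin_two_eq hsum',
    tsum_row_zero_neg hK, ← tsum_rows_neg hK]
  · simp only [lin, Matrix.cons_val_zero, Matrix.cons_val_one, Int.cast_natCast]
  · intro v
    rw [lin_neg, map_neg, Odd.neg_pow ⟨K, rfl⟩, neg_mul_neg]

lemma harmonicEis_of_neg {K : ℕ} (hK : 0 < K) (z : ℍ) :
    harmonicEis (-(2 * K : ℕ)) z = 1 + epsOverZeta (-(2 * K : ℕ)) *
        (riemannZeta (2 - ((-(2 * K : ℕ) : ℤ) : ℂ)) /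
            (2 * (π : ℂ) * I) ^ (-(2 * K : ℕ) : ℤ) *
            ((z.im : ℂ) / (π : ℂ)) ^ (1 - (-(2 * K : ℕ) : ℤ))
          + ∑' m : ℕ+, holTerm (-(2 * K : ℕ)) z m
          + ∑' m : ℕ+, nonholTerm (-(2 * K : ℕ)) z m) := by
  have hy : (z.im : ℂ) ≠ 0 := by exact_mod_cast z.im_pos.ne'
  have hpi : (π : ℂ) ≠ 0 := by exact_mod_cast Real.pi_ne_zero
  have hk0 : (-(2 * K : ℕ) : ℤ) ≠ 0 := by omega
  have hkneg : ¬ (0 : ℤ) ≤ -(2 * K : ℕ) := by omega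
  have heven : Even (-(2 * K : ℕ) : ℤ) := ⟨-K, by push_cast; ring⟩
  have hhalf : ((-(2 * K : ℕ) : ℤ) : ℂ) / 2 = -K := by push_cast; ring
  have hhalf' : -((-(2 * K : ℕ) : ℤ) : ℂ) / 2 = K := by push_cast; ring
  have hz : riemannZeta (2 * K + 1) ≠ 0 := by
    apply riemannZeta_ne_zero_of_one_lt_re
    have : (1 : ℝ) ≤ K := by exact_mod_cast hK
    simp
    linarith
  have hre : 1 < (K + 1 : ℂ).re := by
    have : (1 : ℝ) ≤ K := by exact_mod_cast hK
    simp; linarith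
  have hnat : (-(2 * K : ℕ) : ℤ).natAbs / 2 = K := by omega
  have hf : ((2 * K).factorial : ℂ) ≠ 0 := by exact_mod_cast (2 * K).factorial_ne_zero
  have hG : Gamma (K + 1 + K : ℂ) = (2 * K).factorial := by
    rw [← Gamma_nat_eq_factorial]; push_cast; ring_nf
  have hpe : (π : ℂ) ^ (-(K + 1 : ℂ)) = ((π : ℂ) ^ (K + 1))⁻¹ := by
    rw [cpow_neg, show (K + 1 : ℂ) = ((K + 1 : ℕ) : ℂ) by push_cast; rfl, cpow_natCast]
  rw [harmonicEis, if_neg hk0, hhalf, hhalf',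
    (completedEis_eventuallyEq heven z (Or.inl hk0)).eq_of_nhds, thetaK_half_of_neg hK,
    show (-(K : ℂ)) = 1 - (K + 1) by ring, eisLambda_one_sub heven,
    eisLambda_of_one_lt_re heven z hre, tsum_latTerm_neg_weight hK, hnat, hG, hpe, cpow_natCast,
    epsOverZeta, if_neg hk0, eps, if_neg hkneg]
  have e1 : (1 : ℂ) - ((-(2 * K : ℕ) : ℤ) : ℂ) = 2 * K + 1 := by push_cast; ring
  have e2 : (2 : ℂ) - ((-(2 * K : ℕ) : ℤ) : ℂ) = 2 * K + 2 := by push_cast; ring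
  have e3 : (1 : ℤ) - (-(2 * K : ℕ) : ℤ) = ((2 * K + 1 : ℕ) : ℤ) := by push_cast; ring
  rw [e1, e2, e3, zpow_neg, zpow_neg, zpow_natCast, zpow_natCast, zpow_natCast]
  generalize ∑' m : ℕ+, holTerm (-(2 * K : ℕ)) z m = A
  generalize ∑' m : ℕ+, nonholTerm (-(2 * K : ℕ)) z m = B
  generalize riemannZeta (2 * K + 1) = Z at *
  generalize riemannZeta (2 * K + 2) = W
  have e4 : (2 * (π : ℂ) * I) ^ (2 * K) = (-1) ^ K * 4 ^ K * π ^ (2 * K) := by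
    rw [pow_mul, mul_pow, I_sq, mul_pow, ← mul_pow (-1 : ℂ), pow_mul (π : ℂ), ← mul_pow]
    ring
  have e5 : (-4 : ℂ) ^ K = (-1) ^ K * 4 ^ K := by rw [← mul_pow]; norm_num
  have e6 : ((-1 : ℂ) ^ K) * (-1) ^ K = 1 := by rw [← mul_pow]; simp
  have e7 : (-1 : ℂ) ^ K ≠ 0 := pow_ne_zero _ (by norm_num)
  rw [e4, e5, mul_pow (4 : ℂ), div_pow]
  generalize (-1 : ℂ) ^ K = ε at *
  field_simp
  rw [pow_two ε, e6]
  ring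

/-! ### Weight at least four -/

/-- The functional equation of `ζ` identifies `ε(k)/ζ(1 - k)` with the constant that Lipschitz's
formula produces. -/
lemma two_div_riemannZeta_one_sub {m : ℕ} (hm : 0 < m) :
    2 / riemannZeta (1 - (2 * m : ℕ)) =
      (-2 * π * I) ^ (2 * m) / ((2 * m - 1).factorial * riemannZeta (2 * m : ℕ)) := by
  have hpi : (π : ℂ) ≠ 0 := by exact_mod_cast Real.pi_ne_zero
  have hn : ∀ n : ℕ, ((2 * m : ℕ) : ℂ) ≠ -n := by
    intro n h
    have h' : ((2 * m + n : ℕ) : ℂ) = 0 := by push_cast at h ⊢; rw [h]; ring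
    have := Nat.cast_eq_zero.mp h'
    omega
  have h1 : ((2 * m : ℕ) : ℂ) ≠ 1 := by exact_mod_cast (by omega : 2 * m ≠ 1)
  have hG : Gamma ((2 * m : ℕ) : ℂ) = (2 * m - 1).factorial := by
    rw [← Gamma_nat_eq_factorial, Nat.cast_sub (by omega)]
    push_cast; ring_nf
  have hcos : cos (π * ((2 * m : ℕ) : ℂ) / 2) = (-1) ^ m := by
    rw [show (π * ((2 * m : ℕ) : ℂ) / 2 : ℂ) = m * π by push_cast; ring]
    exact_mod_cast Real.cos_nat_mul_pi m
  rw [riemannZeta_one_sub hn h1, hG, hcos, cpow_neg, cpow_natCast]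
  have e4 : (-2 * (π : ℂ) * I) ^ (2 * m) = (-1) ^ m * (2 * π) ^ (2 * m) := by
    rw [pow_mul, pow_mul, ← mul_pow]
    congr 1
    linear_combination (4 * (π : ℂ) ^ 2) * I_sq
  have e6 : ((-1 : ℂ) ^ m) * (-1) ^ m = 1 := by rw [← mul_pow]; simp
  have e7 : (-1 : ℂ) ^ m ≠ 0 := pow_ne_zero _ (by norm_num)
  rw [e4]
  generalize (-1 : ℂ) ^ m = ε at *
  field_simp
  linear_combination (-((2 * m - 1).factorial * riemannZeta (2 * m : ℕ))⁻¹) * e6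

lemma sigma_natCast (n : ℕ) (hn : 0 < n) (m : ℕ+) :
    sigma ((n : ℤ) - 1) m = (ArithmeticFunction.sigma (n - 1) m : ℂ) := by
  rw [sigma, ArithmeticFunction.sigma_apply, Nat.cast_sum]
  refine Finset.sum_congr rfl fun d _ => ?_
  rw [show (n : ℤ) - 1 = ((n - 1 : ℕ) : ℤ) by omega, zpow_natCast]
  push_cast
  rfl

lemma nonholTerm_of_pos {k : ℤ} (hk : 0 < k) (z : ℍ) (m : ℕ+) : nonholTerm k z m = 0 := by
  have : (1 - k).toNat = 0 := by omega
  simp [nonholTerm, this]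

lemma harmonicEis_eq_of_tendsto {m : ℕ} (hm : 0 < m) (z : ℍ) {L : ℂ}
    (hL : completedEis (2 * m : ℕ) z m / thetaK (2 * m : ℕ) m = (z.im : ℂ) ^ m * L) :
    harmonicEis (2 * m : ℕ) z = L := by
  have hy : (z.im : ℂ) ≠ 0 := by exact_mod_cast z.im_pos.ne'
  have h0 : ((2 * m : ℕ) : ℤ) ≠ 0 := by omega
  rw [harmonicEis, if_neg h0]
  have e : (((2 * m : ℕ) : ℤ) : ℂ) / 2 = m := by push_cast; ring
  rw [neg_div, e, hL, cpow_neg, cpow_natCast]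
  field_simp

lemma latTerm_pos_weight {m : ℕ} (z : ℍ) (s : ℂ) {v : Fin 2 → ℤ} (hv : v ≠ 0) :
    latTerm (2 * m : ℕ) z s v = (z.im : ℂ) ^ m * (lin z v ^ (2 * m))⁻¹ *
      ((z.im / ‖lin z v‖ ^ 2 : ℝ) : ℂ) ^ (s - m) := by
  have hw := lin_ne_zero z hv
  have hn : (‖lin z v‖ : ℂ) ≠ 0 := by exact_mod_cast (norm_pos_iff.mpr hw).ne'
  have hy : (z.im : ℂ) ≠ 0 := by exact_mod_cast z.im_pos.ne'
  have hq : ((z.im / ‖lin z v‖ ^ 2 : ℝ) : ℂ) ≠ 0 := by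
    push_cast
    exact div_ne_zero hy (pow_ne_zero _ hn)
  rw [latTerm, cpow_sub _ _ hq, cpow_natCast, zpow_neg, zpow_natCast, div_pow]
  generalize ((z.im / ‖lin z v‖ ^ 2 : ℝ) : ℂ) ^ s = Q
  push_cast
  rw [div_pow, ← pow_mul]
  field_simp

lemma harmonicEis_of_four_le {m : ℕ} (hm : 2 ≤ m) (z : ℍ) :
    harmonicEis (2 * m : ℕ) z = 1 + epsOverZeta (2 * m : ℕ) *
        (riemannZeta (2 - (((2 * m : ℕ) : ℤ) : ℂ)) / (2 * (π : ℂ) * I) ^ ((2 * m : ℕ) : ℤ) *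
            ((z.im : ℂ) / (π : ℂ)) ^ (1 - ((2 * m : ℕ) : ℤ))
          + ∑' n : ℕ+, holTerm (2 * m : ℕ) z n
          + ∑' n : ℕ+, nonholTerm (2 * m : ℕ) z n) := by
  have h0 : ((2 * m : ℕ) : ℤ) ≠ 0 := by omega
  have hpos : (0 : ℤ) < (2 * m : ℕ) := by omega
  have heven : Even ((2 * m : ℕ) : ℤ) := ⟨m, by push_cast; ring⟩
  have hre : 1 < (m : ℂ).re := by rw [natCast_re]; exact_mod_cast hm
  have hhalf : (((2 * m : ℕ) : ℤ) : ℂ) / 2 = m := by push_cast; ring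
  have hθ := thetaK_half_ne_zero heven h0
  rw [hhalf] at hθ
  have hz : riemannZeta (2 * m : ℕ) ≠ 0 := by
    apply riemannZeta_ne_zero_of_one_lt_re
    rw [natCast_re]
    exact_mod_cast (by omega : 1 < 2 * m)
  have hlat : ∑' v, latTerm (2 * m : ℕ) z m v =
      (z.im : ℂ) ^ m * ∑' v, eisSummand (2 * m : ℕ) v z := by
    rw [← tsum_mul_left]
    refine tsum_congr fun v => ?_
    by_cases hv : v = 0
    · rw [hv, latTerm_zero _ _ (by exact_mod_cast (by omega : m ≠ 0))]
      have h2m : (-((2 * m : ℕ) : ℤ)) ≠ 0 := by omega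
      simp only [eisSummand, Pi.zero_apply, Int.cast_zero, zero_mul, add_zero, zero_zpow _ h2m,
        mul_zero]
    · rw [latTerm_pos_weight z _ hv, sub_self, cpow_zero, mul_one, eisSummand, zpow_neg,
        zpow_natCast, lin]
  have h2 := tsum_latTerm heven z hre
  rw [hlat, tsum_eisSummand_eq_tsum_sigma_mul_cexp_pow (by omega) ⟨m, by ring⟩] at h2
  -- `2 - 2m = -2(m - 2 + 1)` is a trivial zero because `m ≥ 2`.
  have hzeta0 : riemannZeta (2 - (((2 * m : ℕ) : ℤ) : ℂ)) = 0 := by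
    have := riemannZeta_neg_two_mul_nat_add_one (m - 2)
    rw [← this, Nat.cast_sub hm]
    congr 1
    push_cast
    ring
  rw [harmonicEis_eq_of_tendsto (L := 1 + (-2 * π * I) ^ (2 * m) /
    ((2 * m - 1).factorial * riemannZeta (2 * m : ℕ)) * ∑' n : ℕ+, holTerm (2 * m : ℕ) z n)
    (by omega) z]
  · rw [epsOverZeta, if_neg h0, eps, if_pos hpos.le, hzeta0]
    simp only [nonholTerm_of_pos hpos, tsum_zero, zero_div, zero_mul, zero_add, add_zero]
    rw [Int.cast_natCast, two_div_riemannZeta_one_sub (by omega)]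
  · rw [(completedEis_eventuallyEq heven z (Or.inl h0)).eq_of_nhds,
      eisLambda_eq_thetaK_mul heven z hre, mul_div_cancel_left₀ _ hθ]
    have e : ∑' n : ℕ+, holTerm (2 * m : ℕ) z n = ∑' n : ℕ+,
        (ArithmeticFunction.sigma (2 * m - 1) n : ℂ) * cexp (2 * π * I * z) ^ (n : ℕ) := by
      refine tsum_congr fun n => ?_
      rw [holTerm, sigma_natCast _ (by omega), cexp_pow_pnat]
    have e3 : (2 * (m : ℂ)) = ((2 * m : ℕ) : ℂ) := by push_cast; ring
    rw [← e, e3] at h2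
    have hf : ((2 * m - 1).factorial : ℂ) ≠ 0 := by exact_mod_cast (2 * m - 1).factorial_ne_zero
    apply mul_left_cancel₀ (mul_ne_zero two_ne_zero hz)
    rw [← h2]
    generalize ∑' n : ℕ+, holTerm (2 * m : ℕ) z n = A
    field_simp

/-! ### Weight two: Hecke's trick -/

/-- A primitive, along horizontal lines, of `-heckeSummand σ`. -/
noncomputable def heckePrimitive (σ : ℝ) (w : ℂ) : ℂ := w⁻¹ * ((normSq w ^ (-σ) : ℝ) : ℂ)

/-- The combination `(1 + σ) w⁻² |w|^(-2σ) + σ |w|^(-2-2σ)` of summands of weights `2` and `0`. -/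
noncomputable def heckeSummand (σ : ℝ) (w : ℂ) : ℂ :=
  (1 + σ) * (w ^ 2)⁻¹ * ((normSq w ^ (-σ) : ℝ) : ℂ) + σ * ((normSq w ^ (-σ - 1) : ℝ) : ℂ)

/-- The derivative of `heckeSummand σ` along horizontal lines. -/
noncomputable def heckeDeriv (σ : ℝ) (w : ℂ) : ℂ :=
  -(2 * (1 + σ) * (w ^ 3)⁻¹ * ((normSq w ^ (-σ) : ℝ) : ℂ)) -
    (1 + σ) * (w ^ 2)⁻¹ * (σ * ((normSq w ^ (-σ - 1) : ℝ) : ℂ) * (2 * w.re)) -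
    σ * ((1 + σ) * ((normSq w ^ (-σ - 2) : ℝ) : ℂ) * (2 * w.re))

lemma ne_zero_of_im {w : ℂ} (hw : w.im ≠ 0) : w ≠ 0 := by
  rintro rfl
  exact hw rfl

lemma hasDerivAt_add_ofReal (w : ℂ) (t : ℝ) : HasDerivAt (fun t : ℝ => w + t) 1 t :=
  ((hasDerivAt_id t).ofReal_comp).const_add w

lemma hasDerivAt_normSq_rpow {w : ℂ} (hw : w.im ≠ 0) (a t : ℝ) :
    HasDerivAt (fun t : ℝ => ((normSq (w + t) ^ a : ℝ) : ℂ))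
      (a * ((normSq (w + t) ^ (a - 1) : ℝ) : ℂ) * (2 * (w + t).re)) t := by
  have h0 : HasDerivAt (fun t : ℝ => normSq (w + t)) (2 * (w + t).re) t := by
    have h1 : HasDerivAt (fun t : ℝ => w.re + t) 1 t := (hasDerivAt_id t).const_add _
    have h2 := (h1.mul h1).add_const (w.im * w.im)
    convert! h2 using 1
    · ext t
      simp [normSq_apply]
    · simp
      ring
  have hne : normSq (w + t) ≠ 0 := by
    rw [Ne, normSq_eq_zero]
    exact ne_zero_of_im (by simpa using hw)
  convert! (h0.rpow_const (p := a) (Or.inl hne)).ofReal_comp using 1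
  push_cast
  ring

lemma normSq_rpow_sub_one {w : ℂ} (hw : w ≠ 0) (a : ℝ) :
    ((normSq w ^ a : ℝ) : ℂ) = w * conj w * ((normSq w ^ (a - 1) : ℝ) : ℂ) := by
  have h : 0 < normSq w := normSq_pos.mpr hw
  rw [mul_conj, Real.rpow_sub_one h.ne', ofReal_div]
  have : (normSq w : ℂ) ≠ 0 := by exact_mod_cast h.ne'
  field_simp

/-- The horizontal derivative is `∂_w + ∂_w̄`. Applied to `w^(-1-σ) w̄^(-σ)` it gives a weight 2
term and a weight 0 term, which explains the coefficients `1 + σ` and `σ`. -/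
lemma hasDerivAt_heckePrimitive (σ : ℝ) {w : ℂ} (hw : w.im ≠ 0) (t : ℝ) :
    HasDerivAt (fun t : ℝ => heckePrimitive σ (w + t)) (-heckeSummand σ (w + t)) t := by
  have hne : w + t ≠ 0 := ne_zero_of_im (by simpa using hw)
  have h := ((hasDerivAt_add_ofReal w t).inv hne).mul (hasDerivAt_normSq_rpow hw (-σ) t)
  convert! h using 1
  have hc : (2 * ((w + t).re : ℂ)) = (w + t) + conj (w + t) := by
    rw [add_conj]
    push_cast
    rfl
  simp only [Pi.inv_apply]
  rw [heckeSummand, normSq_rpow_sub_one hne (-σ), hc]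
  generalize ((normSq (w + t) ^ (-σ - 1) : ℝ) : ℂ) = Q
  push_cast
  field_simp
  ring

lemma hasDerivAt_heckeSummand (σ : ℝ) {w : ℂ} (hw : w.im ≠ 0) (t : ℝ) :
    HasDerivAt (fun t : ℝ => heckeSummand σ (w + t)) (heckeDeriv σ (w + t)) t := by
  have hne : w + t ≠ 0 := ne_zero_of_im (by simpa using hw)
  have h1 := (((hasDerivAt_add_ofReal w t).pow 2).inv (pow_ne_zero 2 hne)).const_mul (1 + σ : ℂ)
  have h := (h1.mul (hasDerivAt_normSq_rpow hw (-σ) t)).add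
    ((hasDerivAt_normSq_rpow hw (-σ - 1) t).const_mul (σ : ℂ))
  convert! h using 1
  rw [heckeDeriv, show -σ - 1 - 1 = -σ - 2 by ring]
  simp only [Pi.inv_apply, Pi.pow_apply]
  push_cast
  field_simp
  ring

lemma norm_normSq_rpow (w : ℂ) (a : ℝ) : ‖((normSq w ^ a : ℝ) : ℂ)‖ = normSq w ^ a := by
  rw [norm_real, Real.norm_of_nonneg (Real.rpow_nonneg (normSq_nonneg w) a)]

lemma normSq_rpow_neg_le {w : ℂ} {b σ : ℝ} (hb0 : 0 < b) (hb1 : b ≤ 1) (hb : b ≤ normSq w)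
    (h0 : 0 ≤ σ) (h1 : σ ≤ 1) : normSq w ^ (-σ) ≤ b⁻¹ := by
  calc normSq w ^ (-σ) ≤ b ^ (-σ) := Real.rpow_le_rpow_of_nonpos hb0 hb (by linarith)
    _ ≤ b ^ (-1 : ℝ) := Real.rpow_le_rpow_of_exponent_ge hb0 hb1 (by linarith)
    _ = b⁻¹ := Real.rpow_neg_one b

/-- The bound is uniform in `σ`; `12` is the value of `2(1 + σ)(1 + 2σ)` at `σ = 1`. -/
lemma norm_heckeDeriv_le {w : ℂ} (hw : w ≠ 0) {b σ : ℝ} (hb0 : 0 < b) (hb1 : b ≤ 1)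
    (hb : b ≤ normSq w) (h0 : 0 ≤ σ) (h1 : σ ≤ 1) :
    ‖heckeDeriv σ w‖ ≤ 12 * b⁻¹ * (‖w‖ ^ 3)⁻¹ := by
  have hr : 0 < ‖w‖ := norm_pos_iff.mpr hw
  have hQ := normSq_rpow_neg_le hb0 hb1 hb h0 h1
  have hN : 0 < normSq w := normSq_pos.mpr hw
  have e1 : normSq w ^ (-σ - 1) = normSq w ^ (-σ) * (‖w‖ ^ 2)⁻¹ := by
    rw [Real.rpow_sub_one hN.ne', normSq_eq_norm_sq, div_eq_mul_inv]
  have e2 : normSq w ^ (-σ - 2) = normSq w ^ (-σ) * (‖w‖ ^ 4)⁻¹ := by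
    rw [show -σ - 2 = -σ - 1 - 1 by ring, Real.rpow_sub_one hN.ne', e1, normSq_eq_norm_sq]
    field_simp
  have hre : ‖(2 * w.re : ℂ)‖ ≤ 2 * ‖w‖ := by
    rw [norm_mul, norm_real, Complex.norm_ofNat]
    have := abs_re_le_norm w
    rw [Real.norm_eq_abs]
    linarith
  have hs : ‖(σ : ℂ)‖ = σ := by rw [norm_real, Real.norm_of_nonneg h0]
  have hs1 : ‖(1 + σ : ℂ)‖ = 1 + σ := by
    rw [← ofReal_one, ← ofReal_add, norm_real, Real.norm_of_nonneg (by linarith)]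
  have hQ0 : 0 ≤ normSq w ^ (-σ) := Real.rpow_nonneg hN.le _
  refine (norm_sub_le _ _).trans ((add_le_add_left (norm_sub_le _ _) _).trans ?_)
  simp only [norm_neg, norm_mul, norm_inv, norm_pow, norm_normSq_rpow, hs, hs1,
    Complex.norm_ofNat]
  rw [e1, e2]
  rw [norm_mul, Complex.norm_ofNat] at hre
  have hre' : ‖(w.re : ℂ)‖ ≤ ‖w‖ := by linarith
  generalize normSq w ^ (-σ) = Q at *
  have hx : 0 ≤ ‖(w.re : ℂ)‖ := norm_nonneg _
  generalize ‖(w.re : ℂ)‖ = x at *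
  generalize ‖w‖ = r at *
  calc _ ≤ 2 * (1 + σ) * (r ^ 3)⁻¹ * Q + (1 + σ) * (r ^ 2)⁻¹ * (σ * (Q * (r ^ 2)⁻¹) * (2 * r)) +
        σ * ((1 + σ) * (Q * (r ^ 4)⁻¹) * (2 * r)) := by gcongr
    _ = (2 * (1 + σ) * (1 + 2 * σ)) * Q * (r ^ 3)⁻¹ := by field_simp; ring
    _ ≤ 12 * b⁻¹ * (r ^ 3)⁻¹ := by
      gcongr
      nlinarith

/-- The difference of `heckeSummand σ w` and its mean over the segment from `w` to `w + 1`. -/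
noncomputable def heckeError (σ : ℝ) (w : ℂ) : ℂ :=
  heckeSummand σ w - (heckePrimitive σ w - heckePrimitive σ (w + 1))

/-- A function differs from its mean over a unit segment by at most the supremum of its derivative,
which gains one power of `|w|`. On the segment, `|w|` and `|w + t|` are comparable through `c`. -/
lemma norm_heckeError_le {w : ℂ} {c σ : ℝ} (hc0 : 0 < c) (hc1 : c ≤ 1) (hc : c ≤ |w.im|)
    (h0 : 0 ≤ σ) (h1 : σ ≤ 1) :
    ‖heckeError σ w‖ ≤ 12 * (c ^ 2)⁻¹ * (1 + c⁻¹) ^ 3 * (‖w‖ ^ 3)⁻¹ := by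
  have hw : w.im ≠ 0 := by
    intro h
    rw [h, abs_zero] at hc
    linarith
  set C := 12 * (c ^ 2)⁻¹ * (1 + c⁻¹) ^ 3 * (‖w‖ ^ 3)⁻¹ with hC
  have hwpos : 0 < ‖w‖ := norm_pos_iff.mpr (ne_zero_of_im hw)
  have hC0 : 0 ≤ C := by positivity
  have hD : ∀ t ∈ Set.Ico (0 : ℝ) 1, ‖heckeDeriv σ (w + t)‖ ≤ C := by
    intro t ht
    have him : (w + t).im = w.im := by simp
    have hne : w + t ≠ 0 := ne_zero_of_im (by rwa [him])
    have hcn : c ≤ ‖w + t‖ := by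
      rw [← him] at hc
      exact hc.trans (abs_im_le_norm _)
    have hb : c ^ 2 ≤ normSq (w + t) := by
      rw [normSq_eq_norm_sq]
      gcongr
    refine (norm_heckeDeriv_le hne (by positivity) (pow_le_one₀ hc0.le hc1) hb h0 h1).trans ?_
    have hle : ‖w‖ ≤ (1 + c⁻¹) * ‖w + t‖ := by
      have h2 : ‖w‖ ≤ ‖w + t‖ + 1 := by
        calc ‖w‖ = ‖(w + t) - t‖ := by rw [add_sub_cancel_right]
          _ ≤ ‖w + t‖ + ‖(t : ℂ)‖ := norm_sub_le _ _
          _ ≤ ‖w + t‖ + 1 := by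
            rw [norm_real, Real.norm_of_nonneg ht.1]
            linarith [ht.2]
      have h3 : 1 ≤ c⁻¹ * ‖w + t‖ := by
        rw [inv_mul_eq_div, le_div_iff₀ hc0]
        linarith
      linarith
    have hpos : 0 < ‖w + t‖ := norm_pos_iff.mpr hne
    rw [hC, mul_assoc (12 * (c ^ 2)⁻¹)]
    refine mul_le_mul_of_nonneg_left ?_ (by positivity)
    rw [← div_eq_mul_inv, le_div_iff₀ (by positivity), inv_mul_le_iff₀ (by positivity),
      mul_comm (‖w + t‖ ^ 3), ← mul_pow]
    gcongr
  have hφ : ∀ t ∈ Set.Icc (0 : ℝ) 1, ‖heckeSummand σ (w + t) - heckeSummand σ w‖ ≤ C := by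
    intro t ht
    have h := norm_image_sub_le_of_norm_deriv_le_segment' (a := 0) (b := 1)
      (f := fun t : ℝ => heckeSummand σ (w + t)) (f' := fun t : ℝ => heckeDeriv σ (w + t))
      (C := C) (fun x _ => (hasDerivAt_heckeSummand σ hw x).hasDerivWithinAt) hD t ht
    simp only [ofReal_zero, add_zero, sub_zero] at h
    exact h.trans (mul_le_of_le_one_right hC0 ht.2)
  -- The increment of this auxiliary function over `[0, 1]` is the error, and its derivative is the
  -- difference just bounded.
  have h := norm_image_sub_le_of_norm_deriv_le_segment' (a := 0) (b := 1)
      (f := fun t : ℝ => heckePrimitive σ (w + t) + t * heckeSummand σ w)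
      (f' := fun t : ℝ => -heckeSummand σ (w + t) + heckeSummand σ w)
      (C := C) (fun x _ => by
        have h1 : HasDerivAt (fun t : ℝ => (t : ℂ) * heckeSummand σ w) (1 * heckeSummand σ w) x :=
          ((hasDerivAt_id x).ofReal_comp).mul_const _
        rw [one_mul] at h1
        exact ((hasDerivAt_heckePrimitive σ hw x).add h1).hasDerivWithinAt)
      (fun x hx => by
        rw [neg_add_eq_sub, norm_sub_rev]
        exact hφ x ⟨hx.1, hx.2.le⟩) 1 ⟨zero_le_one, le_rfl⟩
  simp only [ofReal_zero, ofReal_one, add_zero, sub_zero, zero_mul, one_mul, mul_one] at h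
  rw [heckeError]
  convert! h using 2
  ring

lemma tendsto_heckeSummand {w : ℂ} (hw : w ≠ 0) :
    Tendsto (fun σ : ℝ => heckeSummand σ w) (𝓝 0) (𝓝 (1 / w ^ 2)) := by
  have hN : normSq w ≠ 0 := (normSq_pos.mpr hw).ne'
  have h : ContinuousAt (fun σ : ℝ => heckeSummand σ w) 0 := by
    have h1 : Continuous fun σ : ℝ => normSq w ^ (-σ) :=
      Real.continuous_const_rpow hN |>.comp continuous_neg
    have h2 : Continuous fun σ : ℝ => normSq w ^ (-σ - 1) :=
      Real.continuous_const_rpow hN |>.comp (by fun_prop)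
    unfold heckeSummand
    fun_prop
  have := h.tendsto
  simpa [heckeSummand] using this

lemma tendsto_heckePrimitive {w : ℂ} (hw : w ≠ 0) :
    Tendsto (fun σ : ℝ => heckePrimitive σ w) (𝓝 0) (𝓝 (heckePrimitive 0 w)) := by
  have hN : normSq w ≠ 0 := (normSq_pos.mpr hw).ne'
  have h1 : Continuous fun σ : ℝ => normSq w ^ (-σ) :=
    Real.continuous_const_rpow hN |>.comp continuous_neg
  have h : Continuous fun σ : ℝ => heckePrimitive σ w := by
    unfold heckePrimitive
    fun_prop
  exact h.continuousAt.tendsto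

lemma heckeSummand_zero (w : ℂ) : heckeSummand 0 w = 1 / w ^ 2 := by
  simp [heckeSummand]

lemma tendsto_heckeError {w : ℂ} (hw : w.im ≠ 0) :
    Tendsto (fun σ : ℝ => heckeError σ w) (𝓝 0) (𝓝 (heckeError 0 w)) := by
  have h1 : (w + 1).im ≠ 0 := by simpa using hw
  have := tendsto_heckeSummand (ne_zero_of_im hw)
  rw [← heckeSummand_zero] at this
  exact this.sub ((tendsto_heckePrimitive (ne_zero_of_im hw)).sub
    (tendsto_heckePrimitive (ne_zero_of_im h1)))

lemma tsum_int_telescope {f : ℤ → ℂ} (hs : Summable fun n => f n - f (n + 1))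
    (hf : Tendsto f cofinite (𝓝 0)) : ∑' n, (f n - f (n + 1)) = 0 := by
  have h1 : Tendsto (fun b : ℕ => ∑ n ∈ Finset.Ico (-b : ℤ) b, (f n - f (n + 1))) atTop
      (𝓝 (∑' n, (f n - f (n + 1)))) :=
    SummationFilter.hasSum_symmetricIco_int_iff.mp
      (hs.hasSum.mono_left (SummationFilter.LeAtTop.le_atTop (L := SummationFilter.symmetricIco ℤ)))
  have hpos : Tendsto (fun b : ℕ => f b) atTop (𝓝 0) :=
    hf.comp (Nat.cofinite_eq_atTop ▸ Nat.cast_injective.tendsto_cofinite)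
  have hneg : Tendsto (fun b : ℕ => f (-b)) atTop (𝓝 0) :=
    hf.comp (Nat.cofinite_eq_atTop ▸ (neg_injective.comp Nat.cast_injective).tendsto_cofinite)
  refine tendsto_nhds_unique h1 ?_
  have h2 := hneg.sub hpos
  rw [sub_zero] at h2
  exact h2.congr fun b => (Finset.sum_Ico_int_sub b f).symm

lemma norm_heckeSummand_le {w : ℂ} (hw : 1 ≤ ‖w‖) {σ : ℝ} (h0 : 0 ≤ σ) (h1 : σ ≤ 1) :
    ‖heckeSummand σ w‖ ≤ 3 * (‖w‖ ^ 2)⁻¹ := by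
  have hN : 1 ≤ normSq w := by
    rw [normSq_eq_norm_sq]
    exact one_le_pow₀ hw
  have hQ := normSq_rpow_neg_le one_pos le_rfl hN h0 h1
  rw [inv_one] at hQ
  have e1 : normSq w ^ (-σ - 1) = normSq w ^ (-σ) * (‖w‖ ^ 2)⁻¹ := by
    rw [Real.rpow_sub_one (by linarith), normSq_eq_norm_sq, div_eq_mul_inv]
  have hQ0 : 0 ≤ normSq w ^ (-σ) := Real.rpow_nonneg (by linarith) _
  have hs : ‖(σ : ℂ)‖ = σ := by rw [norm_real, Real.norm_of_nonneg h0]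
  have hs1 : ‖(1 + σ : ℂ)‖ = 1 + σ := by
    rw [← ofReal_one, ← ofReal_add, norm_real, Real.norm_of_nonneg (by linarith)]
  refine (norm_add_le _ _).trans ?_
  simp only [norm_mul, norm_inv, norm_pow, norm_normSq_rpow, hs, hs1]
  rw [e1]
  have : 0 ≤ (‖w‖ ^ 2)⁻¹ := by positivity
  generalize normSq w ^ (-σ) = Q at *
  calc _ = ((1 + 2 * σ) * Q) * (‖w‖ ^ 2)⁻¹ := by ring
    _ ≤ 3 * (‖w‖ ^ 2)⁻¹ := by
      gcongr
      nlinarith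

lemma norm_heckePrimitive_le {w : ℂ} (hw : w ≠ 0) {b σ : ℝ} (hb0 : 0 < b) (hb1 : b ≤ 1)
    (hb : b ≤ normSq w) (h0 : 0 ≤ σ) (h1 : σ ≤ 1) : ‖heckePrimitive σ w‖ ≤ b⁻¹ * ‖w‖⁻¹ := by
  rw [heckePrimitive, norm_mul, norm_normSq_rpow, norm_inv, mul_comm]
  gcongr
  exact normSq_rpow_neg_le hb0 hb1 hb h0 h1

lemma tendsto_heckePrimitive_cofinite {w : ℂ} (hw : w.im ≠ 0) {σ : ℝ} (h0 : 0 ≤ σ) (h1 : σ ≤ 1) :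
    Tendsto (fun n : ℤ => heckePrimitive σ (w + n)) cofinite (𝓝 0) := by
  have hn : Tendsto (fun n : ℤ => ‖w + n‖) cofinite atTop := by
    refine tendsto_atTop_mono (fun n => ?_) (tendsto_atTop_add_const_right _ (-‖w‖)
      (tendsto_norm_cocompact_atTop.comp Int.tendsto_coe_cofinite))
    rw [Function.comp_apply, ← sub_eq_add_neg, Real.norm_eq_abs, ← norm_intCast,
      sub_le_iff_le_add]
    simpa using norm_sub_le (w + n) w
  have h2 := (tendsto_inv_atTop_zero.comp hn).const_mul ((min 1 (w.im ^ 2))⁻¹)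
  rw [mul_zero] at h2
  refine squeeze_zero_norm (fun n => ?_) h2
  have him : (w + n).im = w.im := by simp
  refine norm_heckePrimitive_le (ne_zero_of_im (by rwa [him])) (by positivity) (min_le_left _ _)
    ((min_le_right _ _).trans ?_) h0 h1
  rw [← him, normSq_apply, sq]
  nlinarith [mul_self_nonneg (w + n).re]

/-- The subtracted means telescope along the row, and the primitive tends to zero at both ends. -/
lemma tsum_heckeSummand_eq {w : ℂ} (hw : w.im ≠ 0) {σ : ℝ} (h0 : 0 ≤ σ) (h1 : σ ≤ 1)
    (hs : Summable fun n : ℤ => heckeSummand σ (w + n))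
    (he : Summable fun n : ℤ => heckeError σ (w + n)) :
    ∑' n : ℤ, heckeError σ (w + n) = ∑' n : ℤ, heckeSummand σ (w + n) := by
  have hsub : Summable fun n : ℤ => heckePrimitive σ (w + n) - heckePrimitive σ (w + (n + 1 : ℤ)) :=
    (hs.sub he).congr fun n => by
      rw [heckeError, Int.cast_add, Int.cast_one, ← add_assoc]
      ring
  have h := tsum_int_telescope (f := fun n : ℤ => heckePrimitive σ (w + n)) hsub
    (tendsto_heckePrimitive_cofinite hw h0 h1)
  rw [← sub_zero (∑' n : ℤ, heckeSummand σ (w + n)), ← h, ← hs.tsum_sub hsub]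
  refine tsum_congr fun n => ?_
  rw [heckeError, Int.cast_add, Int.cast_one, ← add_assoc]

lemma summable_norm_row_cube (z : ℍ) :
    Summable fun p : ℕ+ × ℤ => (‖(p.1 : ℂ) * z + p.2‖ ^ 3)⁻¹ := by
  have hinj : Function.Injective fun p : ℕ+ × ℤ => (![(p.1 : ℤ), p.2] : Fin 2 → ℤ) := by
    intro p q h
    have h1 := congrFun h 0
    have h2 := congrFun h 1
    simp at h1 h2
    exact Prod.ext h1 h2
  refine ((summable_norm_lin_rpow z (p := 3) (by norm_num)).comp_injective hinj).congr fun p => ?_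
  rw [Function.comp_apply, Real.rpow_neg (norm_nonneg _), show (3 : ℝ) = ((3 : ℕ) : ℝ) by norm_num,
    Real.rpow_natCast]
  simp [lin]

lemma exists_norm_heckeError_row_le (z : ℍ) : ∃ C : ℝ, ∀ σ : ℝ, 0 ≤ σ → σ ≤ 1 → ∀ p : ℕ+ × ℤ,
    ‖heckeError σ ((p.1 : ℂ) * z + p.2)‖ ≤ C * (‖(p.1 : ℂ) * z + p.2‖ ^ 3)⁻¹ := by
  have hy := z.im_pos
  refine ⟨_, fun σ h0 h1 p => norm_heckeError_le (c := min 1 z.im) (by positivity)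
    (min_le_left _ _) ((min_le_right _ _).trans ?_) h0 h1⟩
  have him : ((p.1 : ℂ) * z + p.2).im = p.1 * z.im := by simp
  have h1p : (1 : ℝ) ≤ p.1 := by exact_mod_cast p.1.pos
  rw [him, abs_of_pos (by positivity)]
  nlinarith

lemma summable_heckeError_row (z : ℍ) {σ : ℝ} (h0 : 0 ≤ σ) (h1 : σ ≤ 1) :
    Summable fun p : ℕ+ × ℤ => heckeError σ ((p.1 : ℂ) * z + p.2) := by
  obtain ⟨C, hC⟩ := exists_norm_heckeError_row_le z
  exact Summable.of_norm_bounded ((summable_norm_row_cube z).mul_left C) (hC σ h0 h1)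

lemma im_row_ne_zero (z : ℍ) (m : ℕ+) : ((m : ℂ) * z).im ≠ 0 := by
  simpa using z.im_pos.ne'

/-- Dominated convergence: `|w|⁻³` is summable over the lattice, whereas the `|w|⁻²` available
before the correction is not. -/
lemma tendsto_tsum_heckeError (z : ℍ) :
    Tendsto (fun σ : ℝ => ∑' m : ℕ+, ∑' n : ℤ, heckeError σ ((m : ℂ) * z + n)) (𝓝[>] 0)
      (𝓝 (∑' m : ℕ+, ∑' n : ℤ, heckeError 0 ((m : ℂ) * z + n))) := by
  obtain ⟨C, hC⟩ := exists_norm_heckeError_row_le z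
  have hev : ∀ᶠ σ : ℝ in 𝓝[>] 0, 0 ≤ σ ∧ σ ≤ 1 := by
    filter_upwards [self_mem_nhdsWithin, nhdsWithin_le_nhds (Iic_mem_nhds one_pos)] with σ h0 h1
    exact ⟨le_of_lt h0, h1⟩
  have h := tendsto_tsum_of_dominated_convergence (𝓕 := 𝓝[>] (0 : ℝ))
    (f := fun σ (p : ℕ+ × ℤ) => heckeError σ ((p.1 : ℂ) * z + p.2))
    (g := fun p => heckeError 0 ((p.1 : ℂ) * z + p.2)) ((summable_norm_row_cube z).mul_left C)
    (fun p => (tendsto_heckeError (by simpa using im_row_ne_zero z p.1)).mono_left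
      nhdsWithin_le_nhds)
    (hev.mono fun σ hσ p => hC σ hσ.1 hσ.2 p)
  rw [(summable_heckeError_row z le_rfl zero_le_one).tsum_prod] at h
  refine h.congr' (hev.mono fun σ hσ => ?_)
  exact (summable_heckeError_row z hσ.1 hσ.2).tsum_prod

lemma tendsto_tsum_heckeSummand_int :
    Tendsto (fun σ : ℝ => ∑' n : ℤ, heckeSummand σ n) (𝓝[>] 0) (𝓝 (2 * riemannZeta 2)) := by
  have hz := two_mul_riemannZeta_eq_tsum_int_inv_pow_of_even (k := 2) le_rfl even_two
  norm_num at hz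
  rw [hz]
  refine tendsto_tsum_of_dominated_convergence (bound := fun n : ℤ => 3 * ((n : ℝ) ^ 2)⁻¹) ?_
    (fun n => ?_) ?_
  · refine Summable.mul_left _ ?_
    simpa using (Real.summable_one_div_int_pow (p := 2)).mpr one_lt_two
  -- At `n = 0` both parts of the summand are `0` by the conventions for inverses and powers of
  -- zero, matching the term `0` in the limit.
  · rcases eq_or_ne n 0 with rfl | hn
    · refine tendsto_const_nhds.congr' ?_
      filter_upwards [self_mem_nhdsWithin] with σ hσ
      have hσ : 0 < σ := hσ
      have : -σ - 1 ≠ 0 := by linarith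
      simp [heckeSummand, Real.zero_rpow this]
    · have := (tendsto_heckeSummand (w := n) (by exact_mod_cast hn)).mono_left
        (nhdsWithin_le_nhds (s := Set.Ioi 0))
      simpa using this
  · filter_upwards [self_mem_nhdsWithin, nhdsWithin_le_nhds (Iic_mem_nhds one_pos)] with σ h0 h1 n
    have h0 : 0 < σ := h0
    rcases eq_or_ne n 0 with rfl | hn
    · have : -σ - 1 ≠ 0 := by linarith
      simp [heckeSummand, Real.zero_rpow this]
    · have hn1 : 1 ≤ ‖(n : ℂ)‖ := by
        rw [norm_intCast]
        exact_mod_cast Int.one_le_abs hn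
      refine (norm_heckeSummand_le hn1 h0.le h1).trans_eq ?_
      rw [norm_intCast, sq_abs]

lemma weighted_latTerm_eq (z : ℍ) {σ : ℝ} (h0 : 0 < σ) (v : Fin 2 → ℤ) :
    (1 + σ) * latTerm 2 z (1 + σ) v + σ * latTerm 0 z (1 + σ) v =
      ((z.im ^ (1 + σ) : ℝ) : ℂ) * heckeSummand σ (lin z v) := by
  have hσ : (1 + σ : ℂ) = ((1 + σ : ℝ) : ℂ) := by push_cast; rfl
  rcases eq_or_ne v 0 with rfl | hv
  · have h1 : (1 + σ : ℂ) ≠ 0 := by rw [hσ]; exact_mod_cast (by linarith : (1 + σ : ℝ) ≠ 0)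
    have h2 : -σ - 1 ≠ 0 := by linarith
    simp [latTerm_zero _ z h1, heckeSummand, Real.zero_rpow h2]
  · have hw := lin_ne_zero z hv
    have hy := z.im_pos
    have hr : 0 < ‖lin z v‖ := norm_pos_iff.mpr hw
    have hN : 0 < normSq (lin z v) := normSq_pos.mpr hw
    have e2 : latTerm 2 z (1 + σ) v = (z.im : ℂ) * (lin z v ^ 2)⁻¹ *
        (((z.im ^ σ * normSq (lin z v) ^ (-σ) : ℝ)) : ℂ) := by
      have h := latTerm_pos_weight (m := 1) z (1 + σ) hv
      norm_num at h
      have e : (z.im : ℂ) / (‖lin z v‖ : ℂ) ^ 2 = ((z.im / normSq (lin z v) : ℝ) : ℂ) := by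
        rw [normSq_eq_norm_sq]
        push_cast
        rfl
      rw [h, e, Real.rpow_neg hN.le, ← div_eq_mul_inv (z.im ^ σ), ← Real.div_rpow hy.le hN.le,
        ofReal_cpow (by positivity)]
    have e0 : latTerm 0 z (1 + σ) v =
        ((z.im ^ (1 + σ) * normSq (lin z v) ^ (-σ - 1) : ℝ) : ℂ) := by
      rw [latTerm, neg_zero, zpow_zero, one_mul, hσ, ← ofReal_cpow (by positivity),
        ← normSq_eq_norm_sq, show -σ - 1 = -(1 + σ) by ring, Real.rpow_neg hN.le,
        ← div_eq_mul_inv, ← Real.div_rpow hy.le hN.le]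
    rw [e2, e0, heckeSummand, Real.rpow_add hy, Real.rpow_one]
    push_cast
    ring

lemma summable_heckeSummand_lin (z : ℍ) {σ : ℝ} (h0 : 0 < σ) :
    Summable fun v => heckeSummand σ (lin z v) := by
  have hre : 1 < (1 + σ : ℂ).re := by simpa using h0
  have hy : ((z.im ^ (1 + σ) : ℝ) : ℂ) ≠ 0 := by
    exact_mod_cast (Real.rpow_pos_of_pos z.im_pos _).ne'
  rw [← summable_mul_left_iff hy]
  simp only [← weighted_latTerm_eq z h0]
  exact ((summable_norm_latTerm 2 z hre).of_norm.mul_left _).add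
    ((summable_norm_latTerm 0 z hre).of_norm.mul_left _)

lemma heckeSummand_neg (σ : ℝ) (w : ℂ) : heckeSummand σ (-w) = heckeSummand σ w := by
  rw [heckeSummand, normSq_neg, neg_sq, heckeSummand]

lemma weighted_tsum_latTerm_eq (z : ℍ) {σ : ℝ} (h0 : 0 < σ) (h1 : σ ≤ 1) :
    (1 + σ) * ∑' v, latTerm 2 z (1 + σ) v + σ * ∑' v, latTerm 0 z (1 + σ) v =
      ((z.im ^ (1 + σ) : ℝ) : ℂ) * (∑' n : ℤ, heckeSummand σ n +
        2 * ∑' m : ℕ+, ∑' n : ℤ, heckeError σ ((m : ℂ) * z + n)) := by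
  have hre : 1 < (1 + σ : ℂ).re := by simpa using h0
  have hs := summable_heckeSummand_lin z h0
  rw [← tsum_mul_left, ← tsum_mul_left,
    ← ((summable_norm_latTerm 2 z hre).of_norm.mul_left _).tsum_add
      ((summable_norm_latTerm 0 z hre).of_norm.mul_left _),
    tsum_congr (weighted_latTerm_eq z h0), tsum_mul_left, tsum_fin_two_eq hs]
  · have hrow : ∀ m : ℕ+, ∑' n : ℤ, heckeError σ ((m : ℂ) * z + n) =
        ∑' n : ℤ, heckeSummand σ (lin z ![m, n]) := by
      intro m
      have hlin : ∀ n : ℤ, lin z ![m, n] = (m : ℂ) * z + n := fun n => by simp [lin]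
      simp only [hlin]
      have hinj : Function.Injective fun n : ℤ => (![(m : ℤ), n] : Fin 2 → ℤ) := fun a b h => by
        simpa using congrFun h 1
      exact tsum_heckeSummand_eq (im_row_ne_zero z m) h0.le h1
        ((hs.comp_injective hinj).congr fun n => by rw [Function.comp_apply, hlin])
        ((summable_heckeError_row z h0.le h1).prod_factor m)
    have hzero : ∀ n : ℤ, lin z ![0, n] = n := fun n => by simp [lin]
    simp only [hrow, hzero]
  · intro v
    rw [lin_neg, heckeSummand_neg]

lemma tendsto_mul_eisLambda_zero (z : ℍ) :
    Tendsto (fun s : ℂ => (s - 1) * eisLambda 0 z s) (𝓝[≠] 1) (𝓝 (1 / 2)) := by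
  have h := (eisPair 0 z).Λ_residue_k
  have hk : (eisPair 0 z).k = 1 := by simp [eisPair]
  have hε : (eisPair 0 z).ε • (eisPair 0 z).g₀ = 1 := by simp [eisPair, thetaConst]
  rw [hk, hε, ofReal_one] at h
  have h2 := h.const_mul (1 / 2 : ℂ)
  rw [mul_one] at h2
  refine h2.congr fun s => ?_
  simp only [eisLambda, Int.natAbs_zero, Nat.zero_div, pow_zero, Nat.cast_zero, add_zero,
    smul_eq_mul]
  ring

lemma tsum_row_two (z : ℍ) (m : ℕ+) :
    ∑' n : ℤ, heckeError 0 ((m : ℂ) * z + n) = -4 * π ^ 2 *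
      ∑' r : ℕ+, (r : ℂ) * cexp (2 * π * I * ((r * m : ℕ+) : ℂ) * z) := by
  have h := tsum_inv_pow_eq_qSeries 0 (posMul m z)
  have hs : Summable fun n : ℤ => heckeSummand 0 ((m : ℂ) * z + n) := by
    have := linear_right_summable (z : ℂ) m (k := 2) le_rfl
    simpa [heckeSummand_zero] using this
  rw [tsum_heckeSummand_eq (im_row_ne_zero z m) le_rfl zero_le_one hs
    ((summable_heckeError_row z le_rfl zero_le_one).prod_factor m)]
  simp only [heckeSummand_zero]
  simp only [coe_posMul, zero_add] at h
  rw [h, qSeries]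
  have : (-2 * π * I : ℂ) ^ 2 = -4 * π ^ 2 := by linear_combination (4 * (π : ℂ) ^ 2) * I_sq
  rw [this, Nat.factorial_one, Nat.cast_one, div_one]
  congr 1
  refine tsum_congr fun r => ?_
  rw [pow_one, coe_posMul]
  congr 2
  push_cast
  ring

lemma tsum_rows_two (z : ℍ) : ∑' m : ℕ+, ∑' n : ℤ, heckeError 0 ((m : ℂ) * z + n) =
    -4 * π ^ 2 * ∑' m : ℕ+, holTerm 2 z m := by
  have h := summable_and_tsum_sigma_mul (w := 1)
    (φ := fun N => cexp (2 * π * I * (N : ℂ) * z)) (summable_holTerm 2 z)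
  have e : ∑' m : ℕ+, holTerm 2 z m = ∑' N : ℕ+, sigma 1 N * cexp (2 * π * I * (N : ℂ) * z) := rfl
  have hcomm := Summable.tsum_comm (f := fun d r : ℕ+ => ((d : ℕ) : ℂ) ^ (1 : ℤ) *
    cexp (2 * π * I * ((d * r : ℕ+) : ℂ) * z)) h.1
  rw [e, h.2, ← hcomm, ← tsum_mul_left]
  refine tsum_congr fun m => ?_
  rw [tsum_row_two]
  simp only [zpow_one]

/-- Let `s = 1 + σ → 1` in the weighted sum of the two lattice series. The weight 2 part is
continuous at `1`, and the `-1/2` is the residue of the weight 0 part moved across. -/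
lemma eisLambda_two_one (z : ℍ) : eisLambda 2 z 1 =
    z.im / π * (riemannZeta 2 - 4 * π ^ 2 * ∑' m : ℕ+, holTerm 2 z m) - 1 / 2 := by
  have hpi : (π : ℂ) ≠ 0 := by exact_mod_cast Real.pi_ne_zero
  have hσ : Tendsto (fun σ : ℝ => (1 + σ : ℂ)) (𝓝[>] 0) (𝓝[≠] 1) := by
    refine tendsto_nhdsWithin_iff.mpr ⟨?_, ?_⟩
    · have : Continuous fun σ : ℝ => (1 + σ : ℂ) := by fun_prop
      simpa using this.tendsto 0 |>.mono_left (nhdsWithin_le_nhds (s := Set.Ioi 0))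
    · filter_upwards [self_mem_nhdsWithin] with σ h
      have h : 0 < σ := h
      simpa using h.ne'
  have hσ' := hσ.mono_right nhdsWithin_le_nhds
  have hL := ((tendsto_tsum_heckeSummand_int).add ((tendsto_tsum_heckeError z).const_mul 2))
  rw [tsum_rows_two] at hL
  have hy : Tendsto (fun σ : ℝ => ((z.im ^ (1 + σ) : ℝ) : ℂ)) (𝓝[>] 0) (𝓝 z.im) := by
    have : Continuous fun σ : ℝ => ((z.im ^ (1 + σ) : ℝ) : ℂ) :=
      continuous_ofReal.comp ((Real.continuous_const_rpow z.im_pos.ne').comp (by fun_prop))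
    simpa using this.tendsto 0 |>.mono_left (nhdsWithin_le_nhds (s := Set.Ioi 0))
  have hG : ContinuousAt (fun s : ℂ => 1 / 2 * (π : ℂ) ^ (-s) * Gamma (s + 1)) 1 := by
    have h1 : ContinuousAt Gamma (1 + 1 : ℂ) := by
      refine (differentiableAt_Gamma _ fun n h => ?_).continuousAt
      have h' : ((2 + n : ℕ) : ℂ) = 0 := by push_cast; rw [← sub_neg_eq_add, ← h]; ring
      exact absurd (Nat.cast_eq_zero.mp h') (by omega)
    have h2 : ContinuousAt (fun s : ℂ => Gamma (s + 1)) 1 :=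
      ContinuousAt.comp (f := fun s : ℂ => s + 1) h1 (by fun_prop)
    have h3 : Continuous fun s : ℂ => (π : ℂ) ^ (-s) :=
      continuous_neg.const_cpow (Or.inl hpi)
    exact (continuousAt_const.mul h3.continuousAt).mul h2
  have hR := (hG.tendsto.comp hσ').mul (hy.mul hL)
  -- The gamma factors are `Γ(s + 1)` in weight 2 and `Γ(s)` in weight 0, so multiplying the
  -- weighted sum by `Γ(s + 1)` gives the coefficients `s` and `s(s - 1)`.
  have hl1 : Tendsto (fun s : ℂ => s * eisLambda 2 z s + s * ((s - 1) * eisLambda 0 z s)) (𝓝[≠] 1)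
      (𝓝 (1 * eisLambda 2 z 1 + 1 * (1 / 2))) := by
    have hid : Tendsto (fun s : ℂ => s) (𝓝[≠] 1) (𝓝 1) := nhdsWithin_le_nhds
    refine (hid.mul ?_).add (hid.mul (tendsto_mul_eisLambda_zero z))
    exact (analyticAt_eisLambda 2 z (Or.inl two_ne_zero)).continuousAt.tendsto.mono_left
      nhdsWithin_le_nhds
  have key := tendsto_nhds_unique (hl1.comp hσ) (hR.congr' ?_)
  · rw [cpow_neg, cpow_one, Gamma_add_one _ one_ne_zero, Gamma_one] at key
    field_simp at key ⊢
    linear_combination key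
  · filter_upwards [self_mem_nhdsWithin, nhdsWithin_le_nhds (Iic_mem_nhds one_pos)] with σ h0 h1
    have h0 : 0 < σ := h0
    have hre : 1 < (1 + σ : ℂ).re := by simpa using h0
    have hs0 : (1 + σ : ℂ) ≠ 0 := by
      intro h
      rw [h] at hre
      norm_num at hre
    simp only [Function.comp_apply]
    rw [← weighted_tsum_latTerm_eq z h0 h1, eisLambda_of_one_lt_re even_two z hre,
      eisLambda_of_one_lt_re Even.zero z hre]
    norm_num
    rw [Gamma_add_one _ hs0]
    ring

/-- The term `-π/(2 y ζ(2))` left by the residue is the `1/y` term of the expansion, by `ζ(0) =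
-1/2`. -/
lemma harmonicEis_two (z : ℍ) :
    harmonicEis (2 * 1 : ℕ) z = 1 + epsOverZeta (2 * 1 : ℕ) *
        (riemannZeta (2 - (((2 * 1 : ℕ) : ℤ) : ℂ)) / (2 * (π : ℂ) * I) ^ ((2 * 1 : ℕ) : ℤ) *
            ((z.im : ℂ) / (π : ℂ)) ^ (1 - ((2 * 1 : ℕ) : ℤ))
          + ∑' n : ℕ+, holTerm (2 * 1 : ℕ) z n
          + ∑' n : ℕ+, nonholTerm (2 * 1 : ℕ) z n) := by
  have hpi : (π : ℂ) ≠ 0 := by exact_mod_cast Real.pi_ne_zero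
  have hy : (z.im : ℂ) ≠ 0 := by exact_mod_cast z.im_pos.ne'
  have hz : riemannZeta 2 ≠ 0 := riemannZeta_ne_zero_of_one_lt_re (by norm_num)
  have hθ : thetaK (2 * 1 : ℕ) ((1 : ℕ) : ℂ) = (π : ℂ)⁻¹ * riemannZeta 2 := by
    have h := thetaK_half_of_pos even_two two_pos
    norm_num at h
    simpa [cpow_neg_one] using h
  have h2 := two_div_riemannZeta_one_sub one_pos
  rw [harmonicEis_eq_of_tendsto one_pos z (L := 1 + (-4 * π ^ 2 / riemannZeta 2) *
    ∑' n : ℕ+, holTerm 2 z n - π / (2 * z.im * riemannZeta 2))]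
  · have hpos : (0 : ℤ) < (2 * 1 : ℕ) := by norm_num
    rw [epsOverZeta, if_neg hpos.ne', eps, if_pos hpos.le, Int.cast_natCast, h2]
    simp only [nonholTerm_of_pos hpos, tsum_zero]
    have e0 : (2 - ((2 * 1 : ℕ) : ℂ)) = 0 := by norm_num
    rw [e0, riemannZeta_zero]
    have e1 : (-2 * π * I : ℂ) ^ (2 * 1) = -4 * π ^ 2 := by
      linear_combination (4 * (π : ℂ) ^ 2) * I_sq
    have e2 : (2 * π * I : ℂ) ^ ((2 * 1 : ℕ) : ℤ) = -4 * π ^ 2 := by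
      rw [zpow_natCast]
      linear_combination (4 * (π : ℂ) ^ 2) * I_sq
    have e3 : (1 - ((2 * 1 : ℕ) : ℤ)) = -1 := by norm_num
    rw [e1, e2, e3, zpow_neg_one]
    norm_num
    field_simp
    ring
  · rw [hθ]
    have hc := (completedEis_eventuallyEq even_two z (s := 1) (Or.inl two_ne_zero)).eq_of_nhds
    norm_num
    rw [hc, eisLambda_two_one]
    field_simp
    ring

end HarmonicEis

/-! ### Assembly according to the weight -/

theorem theorem8p1 (k : ℤ) (hk : Even k) (z : ℍ) :
    -- the objects that enter the definition of `𝔼_k(z)` exist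
    (∀ s : ℂ, 1 < s.re → Summable fun c : Quotient (QuotientGroup.rightRel GammaInf) =>
      eisTerm k z s c.out) ∧
    IsCompletedEis k z (completedEis k z) ∧
    (k ≠ 0 → AnalyticAt ℂ (completedEis k z) ((k : ℂ) / 2) ∧
      AnalyticAt ℂ (thetaK k) ((k : ℂ) / 2) ∧ thetaK k ((k : ℂ) / 2) ≠ 0) ∧
    (k = 0 → Filter.Tendsto (fun s : ℂ => completedEis 0 z s / thetaK 0 s)
      (nhdsWithin (0 : ℂ) {0}ᶜ) (nhds (harmonicEis 0 z))) ∧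
    -- the two series converge absolutely, and the expansion holds
    Summable (holTerm k z) ∧
    Summable (nonholTerm k z) ∧
    harmonicEis k z =
      1 + epsOverZeta k *
        (riemannZeta (2 - (k : ℂ)) / (2 * (Real.pi : ℂ) * Complex.I) ^ k *
            ((z.im : ℂ) / (Real.pi : ℂ)) ^ (1 - k)
          + ∑' m : ℕ+, holTerm k z m
          + ∑' m : ℕ+, nonholTerm k z m) := by
  refine ⟨fun s hs => summable_eisTerm k z hs, isCompletedEis_completedEis hk z,
    fun h0 => ⟨(analyticAt_eisLambda k z (Or.inl h0)).congr
      (completedEis_eventuallyEq hk z (Or.inl h0)).symm, ?_, thetaK_half_ne_zero hk h0⟩,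
    fun _ => ?_, summable_holTerm k z, summable_nonholTerm k z, ?_⟩
  · exact analyticAt_thetaK k (half_weight hk h0).1 (half_weight hk h0).2
  · rw [harmonicEis_zero]
    exact tendsto_completedEis_div_thetaK_zero z
  · obtain ⟨m, rfl⟩ := hk
    rcases lt_trichotomy m 0 with hm | rfl | hm
    · obtain ⟨K, rfl⟩ : ∃ K : ℕ, m = -K := ⟨m.natAbs, by omega⟩
      rw [show (-K + -K : ℤ) = -(2 * K : ℕ) by push_cast; ring]
      exact harmonicEis_of_neg (by omega) z
    · rw [add_zero, harmonicEis_zero, epsOverZeta, if_pos rfl, zero_mul, add_zero]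
    · obtain ⟨M, rfl⟩ : ∃ M : ℕ, m = M := ⟨m.natAbs, by omega⟩
      rw [show (M + M : ℤ) = (2 * M : ℕ) by push_cast; ring]
      rcases (by omega : M = 1 ∨ 2 ≤ M) with rfl | hM
      · exact harmonicEis_two z
      · exact harmonicEis_of_four_le hM z
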